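/- Theorem 1.3 (Law of the iterated logarithm). Let $m>1/2$ and $\theta\in\mathbb R$, and let $f(x)=c_m(1+x^2)^{-m}$ with $c_m=\left(\int_{\mathbb R}(1+x^2)^{-m}\,dx\right)^{-1}$. Let $(X_n)_{n\ge1}$ be i.i.d. real random variables on a probability space $(\Omega,\mathcal F,P)$ following the Pearson Type VII distribution with location $\theta$ and scale $1$, that is, with density $x\mapsto f(x-\theta)$. For each $n\ge1$ let $\hat\theta_n=\hat\theta_n(X_1,\dots,X_n)$ be a maximum likelihood estimator of the location parameter, where $(x_1,\dots,x_n)\mapsto\hat\theta_n(x_1,\dots,x_n)$ is any measurable function on $\mathbb R^n$ such that, for every $(x_1,\dots,x_n)\in\mathbb R^n$, the point $\hat\theta_n(x_1,\dots,x_n)$ is a global maximizer of $t\mapsto\prod_{i=1}^n f(x_i-t)$ over $t\in\mathbb R$. Then $$\limsup_{n\to\infty}\sqrt{\frac{n}{\log\log n}}\,\bigl(\hat\theta_n-\theta\bigr)=\sqrt{\frac{2(m+1)}{m(2m-1)}}\qquad P\text{-almost surely.}$$ -/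

import Mathlib

open MeasureTheory ProbabilityTheory Filter Topology

noncomputable section

namespace PearsonVII

/-- The normalizing constant `c_m = (∫ (1 + x²)^(-m) dx)⁻¹`. -/
def normConst (m : ℝ) : ℝ := (∫ x : ℝ, (1 + x ^ 2) ^ (-m))⁻¹

/-- The density of the Pearson Type VII distribution with shape `m`, location `μ`, scale `σ`. -/
def density (m μ σ x : ℝ) : ℝ := normConst m * (1 / σ) * (1 + ((x - μ) / σ) ^ 2) ^ (-m)

/-- The Pearson Type VII distribution with shape `m`, location `μ` and scale `σ`, as a measure on
the real line. -/
def dist (m μ σ : ℝ) : Measure ℝ := volume.withDensity fun x => ENNReal.ofReal (density m μ σ x)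

/-- The likelihood of the location parameter `t` given the sample `x` of size `n`
(the scale is known and equal to `1`). -/
def likelihood (m : ℝ) {n : ℕ} (x : Fin n → ℝ) (t : ℝ) : ℝ := ∏ i, density m 0 1 (x i - t)

/-- `T` is a maximum likelihood estimator of the location parameter from samples of size `n`: a
measurable function of the sample which, at every sample point, is a global maximizer of the
likelihood. -/
structure IsMLE (m : ℝ) {n : ℕ} (T : (Fin n → ℝ) → ℝ) : Prop where
  measurable : Measurable T
  isMax : ∀ (x : Fin n → ℝ) (t : ℝ), likelihood m x t ≤ likelihood m x (T x)

end PearsonVII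

end

/-! Write `Y i = X i - θ` and let `δ n` be the estimation error. The estimator is a critical point
of the log-likelihood, so the bounded odd function `score` satisfies `∑ score (Y i - δ n) = 0`. An
exact difference quotient turns this into `∑ score (Y i) = δ n * ∑ scoreSlope (δ n) (Y i)`. Once `δ
n → 0`, the averaged slopes tend to `A = E[scoreDeriv (Y 0)]` by the strong law. Hence `δ n` behaves
like `(∑ score (Y i)) / (n * A)`, and the law of the iterated logarithm for the bounded scores, of
variance `v`, gives the limsup `√(2 * v) / A`. A recursion for the integrals of `(1 + x ^ 2) ^ (-k)`
evaluates `v` and `A`.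

Consistency (`tendsto_zero_of_minimizes`) follows Wald: the expected loss has a strict minimum at
`0` by Gibbs' inequality, the loss is Lipschitz in the location, and a coercivity bound confines the
minimizers to a compact set.

The law of the iterated logarithm rests on two-sided Gaussian bounds for moment generating
functions. The upper half (`ae_eventually_sum_le`) combines Doob's maximal inequality on geometric
blocks with the first Borel–Cantelli lemma. The lower half (`ae_frequently_le_sum`) needs a matching
lower tail bound (`half_exp_le_measureReal`) and the second Borel–Cantelli lemma on independent
blocks. -/

namespace BoundedLIL

/-! ### Elementary bounds and Borel–Cantelli -/

theorem exp_le_of_abs_le {η x : ℝ} (hη : η ≤ 1) (hx : |x| ≤ η) :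
    Real.exp x ≤ 1 + x + x ^ 2 / 2 * (1 + η) := by
  have h := Real.exp_bound (hx.trans hη) (n := 3) (by norm_num)
  simp [Finset.sum_range_succ, Nat.factorial] at h
  have h3 : |x| ^ 3 ≤ η * x ^ 2 := by
    rw [pow_succ', sq_abs]; exact mul_le_mul_of_nonneg_right hx (sq_nonneg x)
  have := (abs_le.mp h).2
  have h0 : 0 ≤ η * x ^ 2 := mul_nonneg ((abs_nonneg x).trans hx) (sq_nonneg x)
  nlinarith

theorem le_exp_of_abs_le {η x : ℝ} (hη : η ≤ 1) (hx : |x| ≤ η) :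
    1 + x + x ^ 2 / 2 * (1 - η) ≤ Real.exp x := by
  have h := Real.exp_bound (hx.trans hη) (n := 3) (by norm_num)
  simp [Finset.sum_range_succ, Nat.factorial] at h
  have h3 : |x| ^ 3 ≤ η * x ^ 2 := by
    rw [pow_succ', sq_abs]; exact mul_le_mul_of_nonneg_right hx (sq_nonneg x)
  have := (abs_le.mp h).1
  have h0 : 0 ≤ η * x ^ 2 := mul_nonneg ((abs_nonneg x).trans hx) (sq_nonneg x)
  nlinarith

theorem abs_sum_le {Ω : Type*} {X : ℕ → Ω → ℝ} {B : ℝ} (hb : ∀ i ω, |X i ω| ≤ B) (s : Finset ℕ) (ω : Ω) :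
    |∑ i ∈ s, X i ω| ≤ s.card * B :=
  (Finset.abs_sum_le_sum_abs _ _).trans
    ((Finset.sum_le_sum fun i _ => hb i ω).trans (by simp))

theorem ae_eventually_notMem_of_le_ofReal {Ω : Type*} [MeasurableSpace Ω] {P : Measure Ω} {A : ℕ → Set Ω} {g : ℕ → ℝ} (hg : Summable g)
    (h : ∀ᶠ k in atTop, P (A k) ≤ ENNReal.ofReal (g k)) : ∀ᵐ ω ∂P, ∀ᶠ k in atTop, ω ∉ A k := by
  obtain ⟨K, hK⟩ := eventually_atTop.mp h
  have h1 : ∑' k, P (A (k + K)) ≠ ⊤ := by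
    refine ne_top_of_le_ne_top ?_ (ENNReal.tsum_le_tsum fun k => hK (k + K) (by omega))
    exact ((summable_nat_add_iff K).mpr hg).tsum_ofReal_ne_top
  filter_upwards [ae_eventually_notMem h1] with ω hω
  exact (eventually_atTop.mp hω).elim fun N hN =>
    eventually_atTop.mpr ⟨N + K, fun k hk => by
      have := hN (k - K) (by omega)
      rwa [Nat.sub_add_cancel (by omega)] at this⟩

section

variable {Ω : Type*} [MeasurableSpace Ω] {P : Measure Ω} [IsProbabilityMeasure P]

/-! ### Gaussian bounds on moment generating functions -/

theorem integrable_of_abs_le {Z : Ω → ℝ} (hZ : Measurable Z) {C : ℝ} (h : ∀ ω, |Z ω| ≤ C) :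
    Integrable Z P :=
  Integrable.of_bound hZ.aestronglyMeasurable C (Eventually.of_forall h)

theorem integrable_exp_mul {Z : Ω → ℝ} (hZ : Measurable Z) {C : ℝ} (h : ∀ ω, |Z ω| ≤ C) (l : ℝ) :
    Integrable (fun ω => Real.exp (l * Z ω)) P := by
  refine integrable_of_abs_le (by fun_prop) (C := Real.exp (|l| * C)) fun ω => ?_
  rw [abs_of_pos (Real.exp_pos _)]
  refine Real.exp_le_exp.mpr ((le_abs_self _).trans ?_)
  rw [abs_mul]
  exact mul_le_mul_of_nonneg_left (h ω) (abs_nonneg l)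

theorem integral_quadratic {Z : Ω → ℝ} (hZ : Measurable Z) {B v : ℝ} (hb : ∀ ω, |Z ω| ≤ B)
    (h0 : ∫ ω, Z ω ∂P = 0) (hv : ∫ ω, Z ω ^ 2 ∂P = v) (l d : ℝ) :
    Integrable (fun ω => 1 + l * Z ω + (l * Z ω) ^ 2 / 2 * d) P ∧
      ∫ ω, (1 + l * Z ω + (l * Z ω) ^ 2 / 2 * d) ∂P = 1 + v * l ^ 2 / 2 * d := by
  have i1 : Integrable Z P := integrable_of_abs_le hZ hb
  have i2 : Integrable (fun ω => Z ω ^ 2) P := by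
    refine integrable_of_abs_le (by fun_prop) (C := B ^ 2) fun ω => ?_
    rw [abs_pow]
    exact pow_le_pow_left₀ (abs_nonneg _) (hb ω) 2
  have e : (fun ω => 1 + l * Z ω + (l * Z ω) ^ 2 / 2 * d)
      = fun ω => (1 + l * Z ω) + (l ^ 2 / 2 * d) * Z ω ^ 2 := by
    ext ω; ring
  have i3 : Integrable (fun ω => 1 + l * Z ω) P := (integrable_const 1).add (i1.const_mul l)
  rw [e]
  refine ⟨i3.add (i2.const_mul _), ?_⟩
  rw [integral_add i3 (i2.const_mul _), integral_add (integrable_const 1) (i1.const_mul l),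
    integral_const_mul, integral_const_mul, h0, hv]
  simp
  ring

theorem mgf_le {Z : Ω → ℝ} (hZ : Measurable Z) {B v η l : ℝ} (hb : ∀ ω, |Z ω| ≤ B)
    (h0 : ∫ ω, Z ω ∂P = 0) (hv : ∫ ω, Z ω ^ 2 ∂P = v) (hη : η ≤ 1) (hl : |l| * B ≤ η) :
    mgf Z P l ≤ Real.exp (v * l ^ 2 / 2 * (1 + η)) := by
  obtain ⟨i, e⟩ := integral_quadratic (P := P) hZ hb h0 hv l (1 + η)
  calc mgf Z P l ≤ ∫ ω, (1 + l * Z ω + (l * Z ω) ^ 2 / 2 * (1 + η)) ∂P := by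
        refine integral_mono (integrable_exp_mul hZ hb l) i fun ω => ?_
        refine exp_le_of_abs_le hη ?_
        rw [abs_mul]
        exact (mul_le_mul_of_nonneg_left (hb ω) (abs_nonneg l)).trans hl
    _ ≤ _ := by
        rw [e]
        linarith [Real.add_one_le_exp (v * l ^ 2 / 2 * (1 + η))]

/-- The quadratic lower bound for `exp` gives `1 + u ≤ mgf Z P l` with `u = v * l ^ 2 / 2 * (1 -
η)`. Since `u ≤ η`, returning to an exponential through `log (1 + u) ≥ u / (1 + u)` costs a second
factor `1 - η`, and `(1 - η) ^ 2 ≥ 1 - 2 * η`. -/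
theorem le_mgf {Z : Ω → ℝ} (hZ : Measurable Z) {B v η l : ℝ} (hb : ∀ ω, |Z ω| ≤ B)
    (h0 : ∫ ω, Z ω ∂P = 0) (hv : ∫ ω, Z ω ^ 2 ∂P = v) (hη : η ≤ 1) (hl : |l| * B ≤ η) :
    Real.exp (v * l ^ 2 / 2 * (1 - 2 * η)) ≤ mgf Z P l := by
  obtain ⟨i, e⟩ := integral_quadratic (P := P) hZ hb h0 hv l (1 - η)
  have hlb : ∀ ω, |l * Z ω| ≤ η := fun ω => by
    rw [abs_mul]
    exact (mul_le_mul_of_nonneg_left (hb ω) (abs_nonneg l)).trans hl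
  obtain ⟨ω₀⟩ : Nonempty Ω := nonempty_of_isProbabilityMeasure P
  have hη0 : 0 ≤ η := (abs_nonneg _).trans (hlb ω₀)
  have hvl : v * l ^ 2 ≤ η ^ 2 := by
    rw [← hv, ← integral_mul_const]
    have : ∫ ω, Z ω ^ 2 * l ^ 2 ∂P ≤ ∫ _, η ^ 2 ∂P := by
      refine integral_mono_of_nonneg (Eventually.of_forall fun ω => by positivity)
        (integrable_const _) (Eventually.of_forall fun ω => ?_)
      have := pow_le_pow_left₀ (abs_nonneg _) (hlb ω) 2
      rw [sq_abs] at this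
      simp only
      linarith [this, mul_pow l (Z ω) 2]
    simpa using this
  have hv0 : 0 ≤ v := by rw [← hv]; exact integral_nonneg fun ω => sq_nonneg _
  set u := v * l ^ 2 / 2 * (1 - η) with hu
  have hw : 0 ≤ v * l ^ 2 := by positivity
  have hu0 : 0 ≤ u := by
    rw [hu]; exact mul_nonneg (by linarith) (by linarith)
  have huη : u ≤ η := by rw [hu]; nlinarith
  have h1 : Real.exp (v * l ^ 2 / 2 * (1 - 2 * η)) ≤ 1 + u := by
    rw [← Real.le_log_iff_exp_le (by linarith)]
    refine le_trans ?_ (Real.one_sub_inv_le_log_of_pos (by linarith))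
    have h2 : 1 - (1 + u)⁻¹ = u / (1 + u) := by field_simp; ring
    rw [h2, le_div_iff₀ (by linarith)]
    have : v * l ^ 2 / 2 * (1 - 2 * η) ≤ u * (1 - η) := by rw [hu]; nlinarith [sq_nonneg η]
    nlinarith
  calc _ ≤ 1 + u := h1
    _ = ∫ ω, (1 + l * Z ω + (l * Z ω) ^ 2 / 2 * (1 - η)) ∂P := by rw [e]
    _ ≤ _ := by
        refine integral_mono i (integrable_exp_mul hZ hb l) fun ω => ?_
        exact le_exp_of_abs_le hη (hlb ω)

variable {X : ℕ → Ω → ℝ} {B v : ℝ}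

theorem mgf_sum_le (hX : ∀ i, Measurable (X i)) (hind : iIndepFun X P) (hb : ∀ i ω, |X i ω| ≤ B)
    (h0 : ∀ i, ∫ ω, X i ω ∂P = 0) (hv : ∀ i, ∫ ω, X i ω ^ 2 ∂P = v) {η l : ℝ} (hη : η ≤ 1)
    (hl : |l| * B ≤ η) (s : Finset ℕ) :
    mgf (fun ω => ∑ i ∈ s, X i ω) P l ≤ Real.exp (s.card * (v * l ^ 2 / 2 * (1 + η))) := by
  have e : (fun ω => ∑ i ∈ s, X i ω) = ∑ i ∈ s, X i := by ext ω; simp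
  rw [e, hind.mgf_sum hX, Real.exp_nat_mul]
  exact (Finset.prod_le_prod (fun i _ => mgf_nonneg)
    fun i _ => mgf_le (hX i) (hb i) (h0 i) (hv i) hη hl).trans (by simp)

theorem le_mgf_sum (hX : ∀ i, Measurable (X i)) (hind : iIndepFun X P) (hb : ∀ i ω, |X i ω| ≤ B)
    (h0 : ∀ i, ∫ ω, X i ω ∂P = 0) (hv : ∀ i, ∫ ω, X i ω ^ 2 ∂P = v) {η l : ℝ} (hη : η ≤ 1)
    (hl : |l| * B ≤ η) (s : Finset ℕ) :
    Real.exp (s.card * (v * l ^ 2 / 2 * (1 - 2 * η))) ≤ mgf (fun ω => ∑ i ∈ s, X i ω) P l := by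
  have e : (fun ω => ∑ i ∈ s, X i ω) = ∑ i ∈ s, X i := by ext ω; simp
  rw [e, hind.mgf_sum hX, Real.exp_nat_mul]
  refine le_trans (by simp) (Finset.prod_le_prod (fun i _ => (Real.exp_pos _).le)
    fun i _ => le_mgf (hX i) (hb i) (h0 i) (hv i) hη hl)

/-! ### Upper half of the law of the iterated logarithm -/

/-- Each new factor has mean at least `1 + l * 0 = 1` and is independent of the past. The sum runs
to `n + 1` because the natural filtration at time `n` already contains `X n`. -/
theorem submartingale_exp (hX : ∀ i, Measurable (X i)) (hind : iIndepFun X P)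
    (hb : ∀ i ω, |X i ω| ≤ B) (h0 : ∀ i, ∫ ω, X i ω ∂P = 0) (l : ℝ) :
    Submartingale (fun n ω => Real.exp (l * ∑ i ∈ Finset.range (n + 1), X i ω))
      (Filtration.natural X fun i => (hX i).stronglyMeasurable) P := by
  set F := Filtration.natural X fun i => (hX i).stronglyMeasurable
  have hmeas : ∀ s : Finset ℕ, Measurable fun ω => ∑ i ∈ s, X i ω := fun s =>
    Finset.measurable_sum _ fun i _ => hX i
  have hint : ∀ n, Integrable (fun ω => Real.exp (l * ∑ i ∈ Finset.range (n + 1), X i ω)) P :=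
    fun n => integrable_exp_mul (hmeas _) (abs_sum_le hb _) l
  have hadp : StronglyAdapted F
      (fun n ω => Real.exp (l * ∑ i ∈ Finset.range (n + 1), X i ω)) := by
    intro n
    have : ∀ i ∈ Finset.range (n + 1), StronglyMeasurable[F n] (X i) := fun i hi =>
      ((Filtration.stronglyAdapted_natural fun i => (hX i).stronglyMeasurable) i).mono
        (F.mono (by simpa [Nat.lt_succ_iff] using hi))
    exact Real.continuous_exp.comp_stronglyMeasurable
      ((Finset.stronglyMeasurable_fun_sum _ this).const_mul l)
  refine submartingale_nat hadp hint fun n => ?_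
  have e : (fun ω => Real.exp (l * ∑ i ∈ Finset.range (n + 1 + 1), X i ω))
      = (fun ω => Real.exp (l * ∑ i ∈ Finset.range (n + 1), X i ω))
        * fun ω => Real.exp (l * X (n + 1) ω) := by
    ext ω
    simp only [Pi.mul_apply]
    rw [Finset.sum_range_succ, mul_add, Real.exp_add]
  have iexp := integrable_exp_mul (P := P) (hX (n + 1)) (hb (n + 1)) l
  have hpull := condExp_mul_of_stronglyMeasurable_left (hadp n) (by rw [← e]; exact hint (n + 1)) iexp
  have hindep : P[fun ω => Real.exp (l * X (n + 1) ω) | F n]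
      =ᵐ[P] fun _ => ∫ ω, Real.exp (l * X (n + 1) ω) ∂P := by
    refine condExp_indep_eq (hX (n + 1)).comap_le (F.le n) ?_
      (hind.indep_comap_natural_of_lt (fun i => (hX i).stronglyMeasurable) (Nat.lt_succ_self n))
    exact (Real.measurable_exp.comp ((comap_measurable (X (n + 1))).const_mul l)).stronglyMeasurable
  have hone : 1 ≤ ∫ ω, Real.exp (l * X (n + 1) ω) ∂P := by
    have i1 : Integrable (X (n + 1)) P := integrable_of_abs_le (hX _) (hb _)
    have : ∫ ω, (l * X (n + 1) ω + 1) ∂P ≤ ∫ ω, Real.exp (l * X (n + 1) ω) ∂P :=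
      integral_mono ((i1.const_mul l).add (integrable_const 1)) iexp
        fun ω => Real.add_one_le_exp _
    rw [integral_add (i1.const_mul l) (integrable_const 1), integral_const_mul, h0] at this
    simpa using this
  rw [e]
  filter_upwards [hpull, hindep] with ω h1 h2
  rw [h1, Pi.mul_apply, h2]
  exact le_mul_of_one_le_right (Real.exp_pos _).le hone

/-- Doob's maximal inequality for the exponential submartingale: the whole block costs no more than
the Chernoff bound at its last time. -/
theorem measure_exists_le_sum_le (hX : ∀ i, Measurable (X i)) (hind : iIndepFun X P)
    (hb : ∀ i ω, |X i ω| ≤ B) (h0 : ∀ i, ∫ ω, X i ω ∂P = 0) (hv : ∀ i, ∫ ω, X i ω ^ 2 ∂P = v)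
    {η l : ℝ} (hη : η ≤ 1) (hl0 : 0 ≤ l) (hl : l * B ≤ η) (a : ℝ) (N : ℕ) :
    P {ω | ∃ n, 1 ≤ n ∧ n ≤ N ∧ a ≤ ∑ i ∈ Finset.range n, X i ω}
      ≤ ENNReal.ofReal (Real.exp (-(l * a) + N * (v * l ^ 2 / 2 * (1 + η)))) := by
  rcases N with _ | N
  · have : {ω | ∃ n, 1 ≤ n ∧ n ≤ 0 ∧ a ≤ ∑ i ∈ Finset.range n, X i ω} = ∅ := by
      ext ω; simp only [Set.mem_ofPred_eq, Set.mem_empty_iff_false, iff_false]; omega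
    rw [this]; simp
  have hmeas : ∀ s : Finset ℕ, Measurable fun ω => ∑ i ∈ s, X i ω := fun s =>
    Finset.measurable_sum _ fun i _ => hX i
  have hd := maximal_ineq (submartingale_exp hX hind hb h0 l)
    (fun n ω => (Real.exp_pos _).le) (ε := (Real.exp (l * a)).toNNReal) N
  set A := {ω | ((Real.exp (l * a)).toNNReal : ℝ) ≤ (Finset.range (N + 1)).sup'
    Finset.nonempty_range_add_one
    fun k => Real.exp (l * ∑ i ∈ Finset.range (k + 1), X i ω)} with hA
  have hsub : {ω | ∃ n, 1 ≤ n ∧ n ≤ N + 1 ∧ a ≤ ∑ i ∈ Finset.range n, X i ω} ⊆ A := by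
    rintro ω ⟨n, h1, h2, h3⟩
    rw [hA, Set.mem_ofPred_eq, Real.coe_toNNReal _ (Real.exp_pos _).le, Finset.le_sup'_iff]
    refine ⟨n - 1, by simp; omega, ?_⟩
    rw [Nat.sub_add_cancel h1]
    exact Real.exp_le_exp.mpr (mul_le_mul_of_nonneg_left h3 hl0)
  have hint : Integrable (fun ω => Real.exp (l * ∑ i ∈ Finset.range (N + 1), X i ω)) P :=
    integrable_exp_mul (hmeas _) (abs_sum_le hb _) l
  have h1 : ∫ ω in A, Real.exp (l * ∑ i ∈ Finset.range (N + 1), X i ω) ∂P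
      ≤ Real.exp ((N + 1 : ℕ) * (v * l ^ 2 / 2 * (1 + η))) := by
    refine (setIntegral_le_integral hint (Eventually.of_forall fun ω => (Real.exp_pos _).le)).trans ?_
    have := mgf_sum_le hX hind hb h0 hv hη (by rwa [abs_of_nonneg hl0]) (Finset.range (N + 1))
    rwa [Finset.card_range] at this
  have h2 := hd.trans (ENNReal.ofReal_le_ofReal h1)
  rw [Real.exp_add, Real.exp_neg, ENNReal.ofReal_mul (by positivity),
    ENNReal.ofReal_inv_of_pos (Real.exp_pos _)]
  refine (measure_mono hsub).trans ?_
  rw [mul_comm, ← div_eq_mul_inv, ENNReal.le_div_iff_mul_le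
    (Or.inl (by simp [Real.exp_pos])) (Or.inl ENNReal.ofReal_ne_top), mul_comm]
  exact h2

theorem ae_eventually_sum_le (hX : ∀ i, Measurable (X i)) (hind : iIndepFun X P)
    (hb : ∀ i ω, |X i ω| ≤ B) (h0 : ∀ i, ∫ ω, X i ω ∂P = 0) (hv : ∀ i, ∫ ω, X i ω ^ 2 ∂P = v)
    (hvpos : 0 < v) {c : ℝ} (hc : 1 < c) :
    ∀ᵐ ω ∂P, ∀ᶠ n : ℕ in atTop,
      ∑ i ∈ Finset.range n, X i ω ≤ c * √(2 * v * (n * Real.log (Real.log n))) := by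
  -- The block ratio is `1 + η`. One factor `1 + η` of the exponent comes from comparing the two
  -- ends of a block, the other from the mgf bound; `η ≤ (c - 1) / 2` keeps `p > 1`, so the block
  -- probabilities are summable.
  set η := min 1 ((c - 1) / 2) with hηdef
  have hη0 : 0 < η := lt_min one_pos (by linarith)
  have hη1 : η ≤ 1 := min_le_left _ _
  have hηc : η ≤ (c - 1) / 2 := min_le_right _ _
  set h := Real.log (1 + η) with hh
  have hhpos : 0 < h := Real.log_pos (by linarith)
  have heh : Real.exp h = 1 + η := Real.exp_log (by linarith)
  set p := 2 * c - (1 + η) * (1 + η) with hp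
  have hp1 : 1 < p := by rw [hp]; nlinarith
  set N : ℕ → ℕ := fun k => ⌊Real.exp ((k + 1 : ℕ) * h)⌋₊ with hN
  set a : ℕ → ℝ := fun k => c * √(2 * v * (Real.exp (k * h) * Real.log (k * h))) with ha
  -- The Gaussian-optimal Chernoff parameter at the threshold `a k` with `c = 1` and time `exp (k *
  -- h)`.
  set l : ℕ → ℝ := fun k => √(2 * Real.log (k * h) / (v * Real.exp (k * h))) with hl
  have hkh : Tendsto (fun k : ℕ => (k : ℝ) * h) atTop atTop :=
    tendsto_natCast_atTop_atTop.atTop_mul_const hhpos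
  have hl0 : Tendsto (fun k => l k * B) atTop (𝓝 0) := by
    have h1 : Tendsto (fun x : ℝ => Real.log x / Real.exp x) atTop (𝓝 0) :=
      (Real.isLittleO_log_id_atTop.trans
        (by simpa [Function.id_def] using Real.isLittleO_pow_exp_atTop (n := 1))).tendsto_div_nhds_zero
    have h2 : Tendsto (fun k : ℕ => √(2 / v * (Real.log (k * h) / Real.exp (k * h))) * B) atTop
        (𝓝 (√(2 / v * 0) * B)) :=
      (((h1.comp hkh).const_mul (2 / v)).sqrt).mul_const B
    simp only [mul_zero, Real.sqrt_zero, zero_mul] at h2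
    refine h2.congr fun k => ?_
    simp only [hl]
    congr 2
    rw [div_mul_div_comm]
  have hbound : ∀ᶠ k : ℕ in atTop,
      P {ω | ∃ n, 1 ≤ n ∧ n ≤ N k ∧ a k ≤ ∑ i ∈ Finset.range n, X i ω}
        ≤ ENNReal.ofReal (h ^ (-p) * (k : ℝ) ^ (-p)) := by
    filter_upwards [hl0.eventually (eventually_le_nhds hη0), hkh.eventually_gt_atTop 1,
      eventually_gt_atTop 0] with k hk1 hk2 hk0
    refine (measure_exists_le_sum_le hX hind hb h0 hv hη1 (Real.sqrt_nonneg _) hk1 (a k)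
      (N k)).trans (ENNReal.ofReal_le_ofReal ?_)
    have hy : 0 < Real.log (k * h) := Real.log_pos hk2
    have hla : l k * a k = 2 * c * Real.log (k * h) := by
      simp only [hl, ha]
      rw [mul_left_comm, ← Real.sqrt_mul (by positivity),
        show 2 * Real.log (k * h) / (v * Real.exp (k * h))
          * (2 * v * (Real.exp (k * h) * Real.log (k * h))) = (2 * Real.log (k * h)) ^ 2 by
          field_simp,
        Real.sqrt_sq (by positivity)]
      ring
    have hl2 : v * l k ^ 2 / 2 = Real.log (k * h) / Real.exp (k * h) := by
      simp only [hl]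
      rw [Real.sq_sqrt (by positivity)]
      field_simp
    have hNk : (N k : ℝ) ≤ Real.exp (k * h) * (1 + η) := by
      refine (Nat.floor_le (Real.exp_pos _).le).trans (le_of_eq ?_)
      rw [← heh, ← Real.exp_add]; congr 1; push_cast; ring
    rw [hla, hl2, ← Real.mul_rpow hhpos.le (Nat.cast_nonneg k), mul_comm h,
      Real.rpow_def_of_pos (by linarith)]
    refine Real.exp_le_exp.mpr ?_
    have : (N k : ℝ) * (Real.log (k * h) / Real.exp (k * h) * (1 + η))
        ≤ Real.exp (k * h) * (1 + η) * (Real.log (k * h) / Real.exp (k * h) * (1 + η)) :=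
      mul_le_mul_of_nonneg_right hNk (by positivity)
    have e : Real.exp (k * h) * (1 + η) * (Real.log (k * h) / Real.exp (k * h) * (1 + η))
        = (1 + η) * (1 + η) * Real.log (k * h) := by
      field_simp
    rw [hp]
    linarith
  have hsum : Summable fun k : ℕ => h ^ (-p) * (k : ℝ) ^ (-p) :=
    (Real.summable_nat_rpow.mpr (by linarith)).mul_left _
  have hlog : Tendsto (fun n : ℕ => Real.log n) atTop atTop :=
    Real.tendsto_log_atTop.comp tendsto_natCast_atTop_atTop
  have hk : Tendsto (fun n : ℕ => ⌊Real.log n / h⌋₊) atTop atTop :=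
    tendsto_nat_floor_atTop.comp (hlog.atTop_div_const hhpos)
  filter_upwards [ae_eventually_notMem_of_le_ofReal hsum hbound] with ω hω
  filter_upwards [hk.eventually hω, hk.eventually (hkh.eventually_gt_atTop 1),
    hlog.eventually_gt_atTop 1, eventually_gt_atTop 0] with n h1 h2 h3 h4
  -- The block containing `n`: its upper end bounds `n` by `N k`, while `a k` uses the lower end and
  -- so stays below the target at `n`.
  set k := ⌊Real.log n / h⌋₊
  have hn : (0 : ℝ) < n := by exact_mod_cast h4
  have hk1 : k * h ≤ Real.log n := by
    rw [← le_div_iff₀ hhpos]; exact Nat.floor_le (by positivity)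
  have hk2 : Real.log n ≤ (k + 1 : ℕ) * h := by
    rw [← div_le_iff₀ hhpos]; push_cast; exact (Nat.lt_floor_add_one _).le
  have hnN : n ≤ N k := by
    refine Nat.le_floor ?_
    rwa [← Real.log_le_iff_le_exp hn]
  have h5 : ∑ i ∈ Finset.range n, X i ω < a k := by
    by_contra! hcon
    exact h1 ⟨n, h4, hnN, hcon⟩
  refine h5.le.trans ?_
  simp only [ha]
  have : Real.exp (k * h) ≤ n := by rwa [← Real.le_log_iff_exp_le hn]
  have h6 : Real.log (k * h) ≤ Real.log (Real.log n) := Real.log_le_log (by linarith) hk1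
  have h7 : 0 < Real.log (k * h) := Real.log_pos h2
  gcongr

/-! ### Lower half of the law of the iterated logarithm -/

/-- Exponential tilting without a change of measure: under the weight `exp ((1 - ε / 2) * u * S)`
most of the mass lies where `(1 - ε) * R ≤ S ≤ R`. The two outer regions are controlled by the mgf
at the neighbouring parameters `(1 - ε) * u` and `u`. -/
theorem half_exp_le_measureReal (hX : ∀ i, Measurable (X i)) (hind : iIndepFun X P)
    (hb : ∀ i ω, |X i ω| ≤ B) (h0 : ∀ i, ∫ ω, X i ω ∂P = 0) (hv : ∀ i, ∫ ω, X i ω ^ 2 ∂P = v)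
    (hvpos : 0 < v) (s : Finset ℕ) (hs : s.Nonempty) {ε y : ℝ} (hε : 0 < ε) (hε1 : ε ≤ 1)
    (hy : 12 / ε ^ 2 ≤ y) (hu : √(2 * y / (v * s.card)) * B ≤ ε ^ 2 / 24) :
    1 / 2 * Real.exp (-(1 - ε ^ 2 / 6) * y)
      ≤ P.real {ω | (1 - ε) * √(2 * v * (s.card * y)) ≤ ∑ i ∈ s, X i ω} := by
  have hB : 0 ≤ B := by
    obtain ⟨ω₀⟩ : Nonempty Ω := nonempty_of_isProbabilityMeasure P
    exact (abs_nonneg _).trans (hb 0 ω₀)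
  have hn : (0 : ℝ) < s.card := by exact_mod_cast hs.card_pos
  set n : ℝ := (s.card : ℝ)
  have hy0 : 0 < y := lt_of_lt_of_le (by positivity) hy
  set u := √(2 * y / (v * n)) with hudef
  set R := √(2 * v * (n * y)) with hR
  have hu0 : 0 ≤ u := Real.sqrt_nonneg _
  have hR0 : 0 ≤ R := Real.sqrt_nonneg _
  have huR : u * R = 2 * y := by
    rw [hudef, hR, ← Real.sqrt_mul (by positivity),
      show 2 * y / (v * n) * (2 * v * (n * y)) = (2 * y) ^ 2 by field_simp,
      Real.sqrt_sq (by positivity)]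
  have hu2 : n * (v * u ^ 2 / 2) = y := by
    rw [hudef, Real.sq_sqrt (by positivity)]; field_simp
  set S : Ω → ℝ := fun ω => ∑ i ∈ s, X i ω with hS
  have hSm : Measurable S := Finset.measurable_sum _ fun i _ => hX i
  have hSb : ∀ ω, |S ω| ≤ n * B := abs_sum_le hb s
  set η := ε ^ 2 / 24 with hη
  have hη1 : η ≤ 1 := by rw [hη]; nlinarith
  have hη0 : 0 ≤ η := by positivity
  have hmgf : ∀ τ, 0 ≤ τ → τ ≤ 1 → |τ * u| * B ≤ η := fun τ h1 h2 => by
    rw [abs_of_nonneg (by positivity)]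
    refine le_trans ?_ hu
    exact mul_le_mul_of_nonneg_right (mul_le_of_le_one_left hu0 h2) hB
  have hup : ∀ τ, 0 ≤ τ → τ ≤ 1 → mgf S P (τ * u) ≤ Real.exp (y * (τ ^ 2 * (1 + η))) := by
    intro τ h1 h2
    refine (mgf_sum_le hX hind hb h0 hv hη1 (hmgf τ h1 h2) s).trans (le_of_eq ?_)
    rw [← hu2]; congr 1; ring
  have hlow : Real.exp (y * ((1 - ε / 2) ^ 2 * (1 - 2 * η))) ≤ mgf S P ((1 - ε / 2) * u) := by
    refine le_trans (le_of_eq ?_)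
      (le_mgf_sum hX hind hb h0 hv hη1 (hmgf (1 - ε / 2) (by linarith) (by linarith)) s)
    rw [← hu2]; congr 1; ring
  set A := {ω | (1 - ε) * R ≤ S ω} with hA
  have hAm : MeasurableSet A := measurableSet_le measurable_const hSm
  -- The three terms dominate on `S < (1 - ε) * R`, on `S > R` and in between; the prefactors make
  -- the exponents agree at the boundaries, where `u * R = 2 * y`.
  have hpt : ∀ ω, Real.exp ((1 - ε / 2) * u * S ω) ≤
      Real.exp (ε * (1 - ε) * y) * Real.exp ((1 - ε) * u * S ω)
        + Real.exp (-(ε * y)) * Real.exp (1 * u * S ω)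
        + Real.exp ((1 - ε / 2) * (2 * y)) * A.indicator (fun _ => (1 : ℝ)) ω := by
    intro ω
    have p1 : 0 ≤ Real.exp (ε * (1 - ε) * y) * Real.exp ((1 - ε) * u * S ω) := by positivity
    have p2 : 0 ≤ Real.exp (-(ε * y)) * Real.exp (1 * u * S ω) := by positivity
    have p3 : 0 ≤ Real.exp ((1 - ε / 2) * (2 * y)) * A.indicator (fun _ => (1 : ℝ)) ω :=
      mul_nonneg (Real.exp_pos _).le (Set.indicator_nonneg (fun _ _ => zero_le_one) _)
    rcases lt_or_ge (S ω) ((1 - ε) * R) with h1 | h1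
    · have : Real.exp ((1 - ε / 2) * u * S ω)
          ≤ Real.exp (ε * (1 - ε) * y) * Real.exp ((1 - ε) * u * S ω) := by
        rw [← Real.exp_add]
        refine Real.exp_le_exp.mpr ?_
        have : u * S ω ≤ (1 - ε) * (2 * y) := by
          rw [← huR]
          calc u * S ω ≤ u * ((1 - ε) * R) := mul_le_mul_of_nonneg_left h1.le hu0
            _ = _ := by ring
        nlinarith
      linarith
    rcases lt_or_ge R (S ω) with h2 | h2
    · have : Real.exp ((1 - ε / 2) * u * S ω) ≤ Real.exp (-(ε * y)) * Real.exp (1 * u * S ω) := by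
        rw [← Real.exp_add]
        refine Real.exp_le_exp.mpr ?_
        have : 2 * y ≤ u * S ω := by
          rw [← huR]; exact mul_le_mul_of_nonneg_left h2.le hu0
        nlinarith
      linarith
    · have hm : ω ∈ A := h1
      rw [Set.indicator_of_mem hm, mul_one] at p3 ⊢
      have : Real.exp ((1 - ε / 2) * u * S ω) ≤ Real.exp ((1 - ε / 2) * (2 * y)) := by
        refine Real.exp_le_exp.mpr ?_
        rw [← huR, mul_assoc]
        exact mul_le_mul_of_nonneg_left (mul_le_mul_of_nonneg_left h2 hu0) (by linarith)
      linarith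
  have i1 := (integrable_exp_mul (P := P) hSm hSb ((1 - ε) * u)).const_mul
    (Real.exp (ε * (1 - ε) * y))
  have i2 := (integrable_exp_mul (P := P) hSm hSb (1 * u)).const_mul (Real.exp (-(ε * y)))
  have i3 : Integrable (fun ω => Real.exp ((1 - ε / 2) * (2 * y))
      * A.indicator (fun _ => (1 : ℝ)) ω) P :=
    ((integrable_const (1 : ℝ)).indicator hAm).const_mul _
  have hint := integral_mono (integrable_exp_mul (P := P) hSm hSb ((1 - ε / 2) * u))
    ((i1.add i2).add i3) hpt
  rw [integral_add' (i1.add i2) i3, integral_add' i1 i2, integral_const_mul, integral_const_mul,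
    integral_const_mul, integral_indicator_const _ hAm, smul_eq_mul, mul_one] at hint
  have e1 : Real.exp (ε * (1 - ε) * y) * ∫ ω, Real.exp ((1 - ε) * u * S ω) ∂P
      ≤ Real.exp (y * (1 - ε + η)) := by
    refine (mul_le_mul_of_nonneg_left (hup (1 - ε) (by linarith) (by linarith))
      (Real.exp_pos _).le).trans ?_
    rw [← Real.exp_add]
    refine Real.exp_le_exp.mpr ?_
    have h1 : (1 - ε) ^ 2 * η ≤ η :=
      mul_le_of_le_one_left hη0 (pow_le_one₀ (by linarith) (by linarith))
    have h2 := mul_le_mul_of_nonneg_left h1 hy0.le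
    linarith
  have e2 : Real.exp (-(ε * y)) * ∫ ω, Real.exp (1 * u * S ω) ∂P
      ≤ Real.exp (y * (1 - ε + η)) := by
    refine (mul_le_mul_of_nonneg_left (hup 1 zero_le_one le_rfl)
      (Real.exp_pos _).le).trans ?_
    rw [← Real.exp_add]
    refine Real.exp_le_exp.mpr (le_of_eq ?_)
    ring
  have hsq : (1 - ε / 2) ^ 2 = 1 - ε + ε ^ 2 / 4 := by ring
  have hsη : (1 - ε / 2) ^ 2 * (2 * η) ≤ 2 * η :=
    mul_le_of_le_one_left (by positivity) (pow_le_one₀ (by linarith) (by linarith))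
  -- Each outer term is thus at most a quarter of the total. The exponent gap is at least `ε ^ 2 / 4
  -- - 3 * η = ε ^ 2 / 8`, and `y ≥ 12 / ε ^ 2` makes it worth `3 / 2`, with `exp (3 / 2) ≥ 4`.
  have e3 : 4 * Real.exp (y * (1 - ε + η)) ≤ Real.exp (y * ((1 - ε / 2) ^ 2 * (1 - 2 * η))) := by
    have h4 : (4 : ℝ) ≤ Real.exp (3 / 2) := by
      have h5 := Real.exp_one_gt_d9
      have h6 := Real.add_one_le_exp (1 / 2 : ℝ)
      have h7 : Real.exp (3 / 2) = Real.exp 1 * Real.exp (1 / 2) := by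
        rw [← Real.exp_add]; norm_num
      rw [h7]; nlinarith
    refine (mul_le_mul_of_nonneg_right h4 (Real.exp_pos _).le).trans ?_
    rw [← Real.exp_add]
    refine Real.exp_le_exp.mpr ?_
    have h6 : 12 ≤ y * ε ^ 2 := by rwa [div_le_iff₀ (by positivity)] at hy
    have h8 : (1 - ε + η) + ε ^ 2 / 8 ≤ (1 - ε / 2) ^ 2 * (1 - 2 * η) := by linarith
    have h9 := mul_le_mul_of_nonneg_left h8 hy0.le
    linarith
  have e4 : 1 / 2 * Real.exp (y * ((1 - ε / 2) ^ 2 * (1 - 2 * η)))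
      ≤ Real.exp ((1 - ε / 2) * (2 * y)) * P.real A := by
    rw [mgf] at hlow
    linarith
  have e5 : Real.exp (-(1 - ε ^ 2 / 6) * y) * Real.exp ((1 - ε / 2) * (2 * y))
      ≤ Real.exp (y * ((1 - ε / 2) ^ 2 * (1 - 2 * η))) := by
    rw [← Real.exp_add]
    refine Real.exp_le_exp.mpr ?_
    have h8 : -(1 - ε ^ 2 / 6) + (1 - ε / 2) * 2 ≤ (1 - ε / 2) ^ 2 * (1 - 2 * η) := by linarith
    have h9 := mul_le_mul_of_nonneg_left h8 hy0.le
    linarith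
  have hpos := Real.exp_pos ((1 - ε / 2) * (2 * y))
  refine le_of_mul_le_mul_left ?_ hpos
  linarith


theorem iIndepSet_of_iIndep_of_pairwise_disjoint {ι κ : Type*} {m : κ → MeasurableSpace Ω}
    (hle : ∀ i, m i ≤ ‹MeasurableSpace Ω›) (hm : iIndep m P) {I : ι → Set κ}
    (hI : Pairwise (Function.onFun Disjoint I)) {A : ι → Set Ω}
    (hA : ∀ k, MeasurableSet[⨆ i ∈ I k, m i] (A k)) : iIndepSet A P := by
  classical
  have hsup : ∀ J : Set κ, (⨆ i ∈ J, m i) ≤ ‹MeasurableSpace Ω› := fun J =>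
    iSup₂_le fun i _ => hle i
  rw [iIndepSet_iff_meas_biInter fun k => hsup _ _ (hA k)]
  intro s
  induction s using Finset.induction_on with
  | empty => simp
  | insert k s hk ih =>
    rw [Finset.prod_insert hk, Finset.set_biInter_insert, ← ih]
    have hdisj : Disjoint (I k) (⋃ j ∈ s, I j) := by
      rw [Set.disjoint_iUnion₂_right]
      exact fun j hj => hI fun h => hk (h ▸ hj)
    refine (Indep_iff _ _ _).mp (indep_iSup_of_disjoint hle hm hdisj) _ _ (hA k) ?_
    refine MeasurableSet.biInter s.countable_toSet fun j hj => ?_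
    exact (iSup_le_iSup_of_subset (f := m) (Set.subset_biUnion_of_mem (u := I) hj)) _ (hA j)

theorem iIndepSet_sum_Ico (hind : iIndepFun X P) (hX : ∀ i, Measurable (X i)) {t : ℕ → ℕ}
    (ht : Monotone t) (a : ℕ → ℝ) :
    iIndepSet (fun k => {ω | a k ≤ ∑ i ∈ Finset.Ico (t k) (t (k + 1)), X i ω}) P := by
  refine iIndepSet_of_iIndep_of_pairwise_disjoint (fun i => (hX i).comap_le)
    ((iIndepFun_iff_iIndep _ _ _).mp hind) (I := fun k => Set.Ico (t k) (t (k + 1)))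
    ht.pairwise_disjoint_on_Ico_succ fun k => ?_
  have hm : Measurable[⨆ i ∈ Set.Ico (t k) (t (k + 1)), MeasurableSpace.comap (X i) inferInstance]
      fun ω => ∑ i ∈ Finset.Ico (t k) (t (k + 1)), X i ω := by
    refine Finset.measurable_fun_sum _ fun i hi => ?_
    refine (comap_measurable (X i)).mono ?_ le_rfl
    exact le_iSup₂_of_le i (by simpa using hi) le_rfl
  exact hm (measurableSet_Ici (a := a k))

/-- Disjoint blocks are independent, and the tail bound is of order `k ^ (-(1 - ε ^ 2 / 6))`, a
divergent series because the exponent has stayed below `1`. -/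
theorem ae_frequently_le_sum_Ico (hX : ∀ i, Measurable (X i)) (hind : iIndepFun X P)
    (hb : ∀ i ω, |X i ω| ≤ B) (h0 : ∀ i, ∫ ω, X i ω ∂P = 0) (hv : ∀ i, ∫ ω, X i ω ^ 2 ∂P = v)
    (hvpos : 0 < v) {q : ℕ} (hq : 2 ≤ q) {ε : ℝ} (hε : 0 < ε) (hε1 : ε ≤ 1) :
    ∀ᵐ ω ∂P, ∃ᶠ k : ℕ in atTop,
      (1 - ε) * √(2 * v * (((q : ℝ) ^ (k + 1) - (q : ℝ) ^ k)
        * Real.log (Real.log ((q : ℝ) ^ (k + 1)))))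
      ≤ ∑ i ∈ Finset.Ico (q ^ k) (q ^ (k + 1)), X i ω := by
  set y : ℕ → ℝ := fun k => Real.log (Real.log ((q : ℝ) ^ (k + 1))) with hy
  set a : ℕ → ℝ := fun k => (1 - ε) * √(2 * v * (((q : ℝ) ^ (k + 1) - (q : ℝ) ^ k) * y k)) with ha
  set A : ℕ → Set Ω := fun k => {ω | a k ≤ ∑ i ∈ Finset.Ico (q ^ k) (q ^ (k + 1)), X i ω} with hA
  have hq2 : (2 : ℝ) ≤ q := by exact_mod_cast hq
  have hlq : 0 < Real.log q := Real.log_pos (by linarith)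
  have hAi : iIndepSet A P :=
    iIndepSet_sum_Ico hind hX (t := fun k => q ^ k) (pow_right_mono₀ (by omega)) a
  have hAm : ∀ k, MeasurableSet (A k) := fun k =>
    measurableSet_le measurable_const (Finset.measurable_fun_sum _ fun i _ => hX i)
  have hL : Tendsto (fun k : ℕ => ((k + 1 : ℕ) : ℝ) * Real.log q) atTop atTop :=
    (tendsto_natCast_atTop_atTop.comp (tendsto_add_atTop_nat 1)).atTop_mul_const hlq
  have hyL : ∀ k, y k = Real.log (((k + 1 : ℕ) : ℝ) * Real.log q) := fun k => by
    simp only [hy, Real.log_pow]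
  have hyt : Tendsto y atTop atTop := by
    refine (Real.tendsto_log_atTop.comp hL).congr fun k => (hyL k).symm
  have hcard : ∀ k, ((Finset.Ico (q ^ k) (q ^ (k + 1))).card : ℝ) = (q : ℝ) ^ (k + 1) - (q : ℝ) ^ k := by
    intro k
    rw [Nat.card_Ico, Nat.cast_sub (Nat.pow_le_pow_right (by omega) (by omega))]
    push_cast; rfl
  have hsmall : Tendsto (fun k => √(2 * y k / (v * ((q : ℝ) ^ (k + 1) - (q : ℝ) ^ k))) * B) atTop
      (𝓝 0) := by
    have h1 : Tendsto (fun x : ℝ => Real.log x / Real.exp x) atTop (𝓝 0) :=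
      (Real.isLittleO_log_id_atTop.trans
        (by simpa [Function.id_def] using Real.isLittleO_pow_exp_atTop (n := 1))).tendsto_div_nhds_zero
    have h2 := ((((h1.comp hL).const_mul (2 / v * (1 - (q : ℝ)⁻¹)⁻¹))).sqrt).mul_const B
    simp only [mul_zero, Real.sqrt_zero, zero_mul] at h2
    refine h2.congr fun k => ?_
    have e : Real.exp (((k + 1 : ℕ) : ℝ) * Real.log q) = (q : ℝ) ^ (k + 1) := by
      rw [Real.exp_nat_mul, Real.exp_log (by linarith)]
    simp only [Function.comp_apply, e, hyL]
    congr 2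
    have : (q : ℝ) ^ (k + 1) - (q : ℝ) ^ k = (q : ℝ) ^ (k + 1) * (1 - (q : ℝ)⁻¹) := by
      rw [pow_succ]; field_simp
    rw [this]
    have : (1 - (q : ℝ)⁻¹) ≠ 0 := by
      have : (q : ℝ)⁻¹ ≤ 2⁻¹ := inv_anti₀ (by norm_num) hq2
      intro h; linarith
    field_simp
  have hprob : ∀ᶠ k in atTop, 1 / 2 * (Real.log q ^ (-(1 - ε ^ 2 / 6))
      * ((k + 1 : ℕ) : ℝ) ^ (-(1 - ε ^ 2 / 6))) ≤ P.real (A k) := by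
    filter_upwards [hyt.eventually_ge_atTop (12 / ε ^ 2),
      hsmall.eventually (eventually_le_nhds (show 0 < ε ^ 2 / 24 by positivity)),
      hL.eventually_gt_atTop 0] with k h1 h2 h3
    have hne : (Finset.Ico (q ^ k) (q ^ (k + 1))).Nonempty := by
      rw [Finset.nonempty_Ico]; exact Nat.pow_lt_pow_right (by omega) (by omega)
    have := half_exp_le_measureReal hX hind hb h0 hv hvpos _ hne hε hε1 h1 (by rwa [hcard])
    rw [hcard] at this
    refine le_trans (le_of_eq ?_) this
    rw [← Real.mul_rpow hlq.le (by positivity), mul_comm (Real.log q), Real.rpow_def_of_pos h3,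
      ← hyL, mul_comm (y k)]
  have htop : ∑' k, P (A k) = ⊤ := by
    by_contra hcon
    obtain ⟨K, hK⟩ := eventually_atTop.mp hprob
    have hs : Summable fun k => P.real (A k) := ENNReal.summable_toReal hcon
    have hsK : Summable fun k => P.real (A (k + K)) :=
      hs.comp_injective (add_left_injective K)
    have h1 : Summable fun k : ℕ => 1 / 2 * (Real.log q ^ (-(1 - ε ^ 2 / 6))
        * ((k + K + 1 : ℕ) : ℝ) ^ (-(1 - ε ^ 2 / 6))) := by
      refine Summable.of_nonneg_of_le (fun k => by positivity) (fun k => hK (k + K) (Nat.le_add_left K k)) hsK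
    have h2 : Summable fun k : ℕ => ((k + (K + 1) : ℕ) : ℝ) ^ (-(1 - ε ^ 2 / 6)) := by
      refine (h1.mul_left (2 * (Real.log q ^ (-(1 - ε ^ 2 / 6)))⁻¹)).congr fun k => ?_
      have hne : Real.log q ^ (-(1 - ε ^ 2 / 6)) ≠ 0 := (Real.rpow_pos_of_pos hlq _).ne'
      rw [add_assoc]
      generalize Real.log q ^ (-(1 - ε ^ 2 / 6)) = c at hne
      generalize ((k + (K + 1) : ℕ) : ℝ) ^ (-(1 - ε ^ 2 / 6)) = x
      field_simp
    have h3 : Summable fun k : ℕ => (k : ℝ) ^ (-(1 - ε ^ 2 / 6)) :=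
      (summable_nat_add_iff (K + 1)).mp h2
    rw [Real.summable_nat_rpow] at h3
    have : 0 < ε ^ 2 := by positivity
    linarith
  have h1 := measure_limsup_eq_one hAm hAi htop
  have h2 : ∀ᵐ ω ∂P, ω ∈ limsup A atTop :=
    (mem_ae_iff_prob_eq_one (MeasurableSet.measurableSet_limsup hAm)).mpr h1
  filter_upwards [h2] with ω hω
  rwa [mem_limsup_iff_frequently_mem] at hω

/-- A large last block carries the sum. The terms before it could only spoil this by being very
negative, which the upper half, applied to `-X` with constant `2`, excludes. -/
theorem ae_frequently_le_sum (hX : ∀ i, Measurable (X i)) (hind : iIndepFun X P)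
    (hb : ∀ i ω, |X i ω| ≤ B) (h0 : ∀ i, ∫ ω, X i ω ∂P = 0) (hv : ∀ i, ∫ ω, X i ω ^ 2 ∂P = v)
    (hvpos : 0 < v) {c : ℝ} (hc0 : 0 < c) (hc : c < 1) :
    ∀ᵐ ω ∂P, ∃ᶠ n : ℕ in atTop,
      c * √(2 * v * (n * Real.log (Real.log n))) ≤ ∑ i ∈ Finset.range n, X i ω := by
  -- The block keeps the fraction `√(1 - 1 / q)` of the scale at `q ^ (k + 1)`; the earlier terms
  -- cost at most `2 * √(1 / q)` of it.
  obtain ⟨q, hqc, hq⟩ : ∃ q : ℕ, c < (1 - (1 - c) / 2) * √(1 - (q : ℝ)⁻¹) - 2 * √((q : ℝ)⁻¹)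
      ∧ 2 ≤ q := by
    have h1 : Tendsto (fun q : ℕ => (1 - (1 - c) / 2) * √(1 - (q : ℝ)⁻¹) - 2 * √((q : ℝ)⁻¹)) atTop
        (𝓝 ((1 - (1 - c) / 2) * √(1 - 0) - 2 * √0)) := by
      have := tendsto_inv_atTop_nhds_zero_nat (𝕜 := ℝ)
      exact (((this.const_sub 1).sqrt).const_mul _).sub (this.sqrt.const_mul 2)
    exact ((h1.eventually (lt_mem_nhds (by simp; linarith))).and (eventually_ge_atTop 2)).exists
  have hq2 : (2 : ℝ) ≤ q := by exact_mod_cast hq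
  have hup := ae_eventually_sum_le (P := P) (X := fun i ω => -X i ω) (fun i => (hX i).neg)
    (hind.comp (fun _ x => -x) fun _ => measurable_neg) (B := B) (fun i ω => by simpa using hb i ω)
    (fun i => by rw [integral_neg, h0, neg_zero]) (v := v) (fun i => by simpa using hv i) hvpos
    (c := 2) one_lt_two
  filter_upwards [hup, ae_frequently_le_sum_Ico hX hind hb h0 hv hvpos hq
    (show 0 < (1 - c) / 2 by linarith) (by linarith)] with ω h1 h2
  have hpow : Tendsto (fun k : ℕ => q ^ k) atTop atTop :=
    tendsto_pow_atTop_atTop_of_one_lt (by omega)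
  refine (hpow.comp (tendsto_add_atTop_nat 1)).frequently ?_
  have hlog : Tendsto (fun k : ℕ => Real.log (Real.log ((q ^ k : ℕ) : ℝ))) atTop atTop :=
    (Real.tendsto_log_atTop.comp Real.tendsto_log_atTop).comp
      (tendsto_natCast_atTop_atTop.comp hpow)
  have hlog' : Tendsto (fun k : ℕ => Real.log ((q ^ k : ℕ) : ℝ)) atTop atTop :=
    Real.tendsto_log_atTop.comp (tendsto_natCast_atTop_atTop.comp hpow)
  refine (h2.and_eventually ((hpow.eventually h1).and ((hlog.eventually_gt_atTop 0).and
    (hlog'.eventually_gt_atTop 0)))).mono ?_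
  rintro k ⟨h3, h4, h5, h6⟩
  simp only [Function.comp_apply, Finset.sum_neg_distrib] at h4 ⊢
  have hqp : (0 : ℝ) < (q : ℝ) ^ k := by positivity
  push_cast at h4 h5 h6 ⊢
  set y := Real.log (Real.log ((q : ℝ) ^ (k + 1))) with hy
  have hle : Real.log (Real.log ((q : ℝ) ^ k)) ≤ y := by
    refine Real.log_le_log h6 (Real.log_le_log hqp ?_)
    exact pow_le_pow_right₀ (by linarith) (by omega)
  have hsplit : ∑ i ∈ Finset.range (q ^ (k + 1)), X i ω
      = ∑ i ∈ Finset.range (q ^ k), X i ω + ∑ i ∈ Finset.Ico (q ^ k) (q ^ (k + 1)), X i ω :=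
    (Finset.sum_range_add_sum_Ico _ (Nat.pow_le_pow_right (by omega) (by omega))).symm
  set M := √(2 * v * ((q : ℝ) ^ (k + 1) * y)) with hM
  have hM0 : 0 ≤ M := Real.sqrt_nonneg _
  have hi : (q : ℝ)⁻¹ ≤ 1 := inv_le_one_of_one_le₀ (by linarith)
  have e1 : √(2 * v * (((q : ℝ) ^ (k + 1) - (q : ℝ) ^ k) * y)) = √(1 - (q : ℝ)⁻¹) * M := by
    rw [hM, ← Real.sqrt_mul (by linarith)]
    congr 1; rw [pow_succ]; field_simp
  have e2 : √(2 * v * ((q : ℝ) ^ k * Real.log (Real.log ((q : ℝ) ^ k)))) ≤ √((q : ℝ)⁻¹) * M := by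
    rw [hM, ← Real.sqrt_mul (by positivity)]
    have : (q : ℝ)⁻¹ * (2 * v * ((q : ℝ) ^ (k + 1) * y)) = 2 * v * ((q : ℝ) ^ k * y) := by
      rw [pow_succ]; field_simp
    rw [this]
    gcongr
  rw [e1] at h3
  rw [hsplit]
  have := mul_le_mul_of_nonneg_right hqc.le hM0
  linarith

end

end BoundedLIL

namespace PearsonVII

/-! ### Integrals against the Pearson VII law -/

theorem integrable_one_add_sq_rpow {k : ℝ} (hk : 1 / 2 < k) :
    Integrable fun x : ℝ => (1 + x ^ 2) ^ (-k) := by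
  have := integrable_rpow_neg_one_add_norm_sq (E := ℝ) (μ := volume) (r := 2 * k)
    (by rw [Module.finrank_self]; push_cast; linarith)
  refine this.congr (Eventually.of_forall fun x => ?_)
  simp only [Real.norm_eq_abs, sq_abs]
  congr 1; ring

theorem one_add_sq_pos (x : ℝ) : 0 < 1 + x ^ 2 := by positivity

theorem continuous_one_add_sq_rpow (k : ℝ) : Continuous fun x : ℝ => (1 + x ^ 2) ^ k :=
  Continuous.rpow_const (by fun_prop) fun x => Or.inl (one_add_sq_pos x).ne'

theorem integral_one_add_sq_rpow_pos {k : ℝ} (hk : 1 / 2 < k) :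
    0 < ∫ x : ℝ, (1 + x ^ 2) ^ (-k) := by
  refine (integral_pos_iff_support_of_nonneg
    (fun x => (Real.rpow_pos_of_pos (one_add_sq_pos x) _).le) (integrable_one_add_sq_rpow hk)).mpr ?_
  have : Function.support (fun x : ℝ => (1 + x ^ 2) ^ (-k)) = Set.univ :=
    Set.eq_univ_of_forall fun x => (Real.rpow_pos_of_pos (one_add_sq_pos x) _).ne'
  rw [this]; simp

theorem normConst_pos {m : ℝ} (hm : 1 / 2 < m) : 0 < normConst m :=
  inv_pos.mpr (integral_one_add_sq_rpow_pos hm)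

theorem normConst_mul_integral {m : ℝ} (hm : 1 / 2 < m) :
    normConst m * ∫ x : ℝ, (1 + x ^ 2) ^ (-m) = 1 :=
  inv_mul_cancel₀ (integral_one_add_sq_rpow_pos hm).ne'

theorem rpow_neg_add_one (x k : ℝ) :
    (1 + x ^ 2) ^ (-(k + 1)) = (1 + x ^ 2) ^ (-k) / (1 + x ^ 2) := by
  rw [neg_add, Real.rpow_add (one_add_sq_pos x), Real.rpow_neg_one, div_eq_mul_inv]

theorem abs_le_one_add_sq (x : ℝ) : |x| ≤ (1 + x ^ 2) / 2 := by
  rw [abs_le]; constructor <;> nlinarith [sq_nonneg (x + 1), sq_nonneg (x - 1)]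

theorem abs_le_rpow_half (x : ℝ) : |x| ≤ (1 + x ^ 2) ^ (1 / 2 : ℝ) := by
  rw [← Real.sqrt_eq_rpow, ← Real.sqrt_sq_eq_abs]
  exact Real.sqrt_le_sqrt (by linarith)

theorem tendsto_mul_rpow {k : ℝ} (hk : 1 / 2 < k) {l : Filter ℝ}
    (hl : Tendsto (fun x : ℝ => |x|) l atTop) :
    Tendsto (fun x : ℝ => x * (1 + x ^ 2) ^ (-k)) l (𝓝 0) := by
  have h1 : Tendsto (fun x : ℝ => 1 + x ^ 2) l atTop := by
    refine tendsto_atTop_mono (fun x => ?_) hl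
    have := abs_le_one_add_sq x
    have := one_add_sq_pos x
    linarith
  have h2 : Tendsto (fun x : ℝ => (1 + x ^ 2) ^ (-(k - 1 / 2))) l (𝓝 0) :=
    (tendsto_rpow_neg_atTop (by linarith)).comp h1
  refine squeeze_zero_norm (fun x => ?_) h2
  rw [norm_mul, Real.norm_eq_abs, Real.norm_of_nonneg (Real.rpow_pos_of_pos (one_add_sq_pos x) _).le]
  calc |x| * (1 + x ^ 2) ^ (-k) ≤ (1 + x ^ 2) ^ (1 / 2 : ℝ) * (1 + x ^ 2) ^ (-k) :=
        mul_le_mul_of_nonneg_right (abs_le_rpow_half x)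
          (Real.rpow_pos_of_pos (one_add_sq_pos x) _).le
    _ = _ := by rw [← Real.rpow_add (one_add_sq_pos x)]; congr 1; ring

/-- The derivative of `x * (1 + x ^ 2) ^ (-k)` is the difference of the two integrands, and the
function vanishes at both infinities since `k > 1 / 2`. -/
theorem integral_rpow_add_one {k : ℝ} (hk : 1 / 2 < k) :
    2 * k * ∫ x : ℝ, (1 + x ^ 2) ^ (-(k + 1)) = (2 * k - 1) * ∫ x : ℝ, (1 + x ^ 2) ^ (-k) := by
  have i1 := integrable_one_add_sq_rpow hk
  have i2 := integrable_one_add_sq_rpow (k := k + 1) (by linarith)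
  have hd : ∀ x : ℝ, HasDerivAt (fun x : ℝ => x * (1 + x ^ 2) ^ (-k))
      (2 * k * (1 + x ^ 2) ^ (-(k + 1)) - (2 * k - 1) * (1 + x ^ 2) ^ (-k)) x := by
    intro x
    have h1 : HasDerivAt (fun x : ℝ => 1 + x ^ 2) (2 * x) x := by
      simpa using (hasDerivAt_pow 2 x).const_add 1
    have h2 := (hasDerivAt_id x).mul (h1.rpow_const (p := -k) (Or.inl (one_add_sq_pos x).ne'))
    refine h2.congr_deriv ?_
    rw [rpow_neg_add_one, Real.rpow_sub_one (one_add_sq_pos x).ne']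
    have := (one_add_sq_pos x).ne'
    simp only [id]
    field_simp
    ring
  have h := integral_of_hasDerivAt_of_tendsto hd ((i2.const_mul _).sub (i1.const_mul _))
    (tendsto_mul_rpow hk tendsto_abs_atBot_atTop) (tendsto_mul_rpow hk tendsto_abs_atTop_atTop)
  rw [integral_sub (i2.const_mul _) (i1.const_mul _), integral_const_mul, integral_const_mul] at h
  linarith

section Expectation

variable {m : ℝ} (hm : 1 / 2 < m) (θ : ℝ)
include hm

theorem integrable_comp_sub_dist {g : ℝ → ℝ} (hg : Integrable fun y => g y * (1 + y ^ 2) ^ (-m)) :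
    Integrable (fun x => g (x - θ)) (dist m θ 1) := by
  have hd : Measurable fun x => density m θ 1 x := by unfold density; fun_prop
  have hpos : ∀ x, 0 ≤ density m θ 1 x := fun x => by
    have := normConst_pos hm
    unfold density; positivity
  rw [dist, integrable_withDensity_iff hd.ennreal_ofReal (by simp)]
  refine ((hg.comp_sub_right θ).const_mul (normConst m)).congr (Eventually.of_forall fun x => ?_)
  simp only [ENNReal.toReal_ofReal (hpos x)]
  simp only [density, div_one]
  ring

theorem integral_comp_sub_dist (g : ℝ → ℝ) :
    ∫ x, g (x - θ) ∂(dist m θ 1) = normConst m * ∫ y, g y * (1 + y ^ 2) ^ (-m) := by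
  have hd : Measurable fun x => density m θ 1 x := by unfold density; fun_prop
  have hpos : ∀ x, 0 ≤ density m θ 1 x := fun x => by
    have := normConst_pos hm
    unfold density; positivity
  rw [dist, integral_withDensity_eq_integral_toReal_smul hd.ennreal_ofReal (by simp),
    ← integral_const_mul,
    ← integral_sub_right_eq_self (fun y => normConst m * (g y * (1 + y ^ 2) ^ (-m))) θ]
  refine integral_congr_ae (Eventually.of_forall fun x => ?_)
  simp only [ENNReal.toReal_ofReal (hpos x)]
  simp only [density, div_one, smul_eq_mul]
  ring

variable {Ω : Type*} [MeasurableSpace Ω] {P : Measure Ω} {Z : Ω → ℝ} (hZ : Measurable Z)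
  (hlaw : P.map Z = dist m θ 1)
include hZ hlaw

theorem integrable_comp_sub {g : ℝ → ℝ} (hgm : Measurable g)
    (hg : Integrable fun y => g y * (1 + y ^ 2) ^ (-m)) :
    Integrable (fun ω => g (Z ω - θ)) P := by
  have h := integrable_comp_sub_dist hm θ hg
  rw [← hlaw] at h
  exact (integrable_map_measure
    (hgm.comp (measurable_id.sub_const θ)).aestronglyMeasurable hZ.aemeasurable).mp h

theorem integral_comp_sub {g : ℝ → ℝ} (hgm : Measurable g) :
    ∫ ω, g (Z ω - θ) ∂P = normConst m * ∫ y, g y * (1 + y ^ 2) ^ (-m) := by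
  rw [← integral_comp_sub_dist hm θ g, ← hlaw]
  exact (integral_map hZ.aemeasurable
    (hgm.comp (measurable_id.sub_const θ)).aestronglyMeasurable).symm

end Expectation

/-- The location score of the Pearson Type VII family, up to the factor `2 * m`. -/
noncomputable def score (y : ℝ) : ℝ := y / (1 + y ^ 2)

/-- The derivative of `score`. -/
noncomputable def scoreDeriv (y : ℝ) : ℝ := (1 - y ^ 2) / (1 + y ^ 2) ^ 2

/-! ### Bounds and moments of the score -/

theorem measurable_score : Measurable score := by unfold score; fun_prop

theorem measurable_scoreDeriv : Measurable scoreDeriv := by unfold scoreDeriv; fun_prop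

theorem abs_score_le (y : ℝ) : |score y| ≤ 1 := by
  rw [score, abs_div, abs_of_pos (one_add_sq_pos y), div_le_one (one_add_sq_pos y)]
  have := abs_le_one_add_sq y
  have := one_add_sq_pos y
  linarith

theorem abs_scoreDeriv_le (y : ℝ) : |scoreDeriv y| ≤ 1 := by
  have := one_add_sq_pos y
  rw [scoreDeriv, abs_div, abs_of_pos (by positivity : 0 < (1 + y ^ 2) ^ 2),
    div_le_one (by positivity), abs_le]
  constructor <;> nlinarith [sq_nonneg y]

theorem integral_score (m : ℝ) : ∫ y, score y * (1 + y ^ 2) ^ (-m) = 0 := by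
  have h := integral_neg_eq_self (fun y : ℝ => score y * (1 + y ^ 2) ^ (-m)) volume
  have e : (fun y : ℝ => score (-y) * (1 + (-y) ^ 2) ^ (-m))
      = fun y => -(score y * (1 + y ^ 2) ^ (-m)) := by
    ext y; simp only [score, neg_sq]; ring
  rw [e, integral_neg] at h
  linarith

theorem normConst_mul_integral_add_one {m : ℝ} (hm : 1 / 2 < m) :
    normConst m * ∫ x : ℝ, (1 + x ^ 2) ^ (-(m + 1)) = (2 * m - 1) / (2 * m) := by
  have h1 := integral_rpow_add_one hm
  have h2 := normConst_mul_integral hm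
  have : m ≠ 0 := by linarith
  rw [eq_div_iff (by positivity)]
  linear_combination normConst m * h1 + (2 * m - 1) * h2

theorem normConst_mul_integral_add_two {m : ℝ} (hm : 1 / 2 < m) :
    normConst m * ∫ x : ℝ, (1 + x ^ 2) ^ (-(m + 1 + 1))
      = (2 * m - 1) / (2 * m) * ((2 * m + 1) / (2 * (m + 1))) := by
  have h1 := integral_rpow_add_one (k := m + 1) (by linarith)
  have h2 := normConst_mul_integral_add_one hm
  have h0 : m + 1 ≠ 0 := by linarith
  rw [← mul_div_assoc, eq_div_iff (by positivity)]
  linear_combination normConst m * h1 + (2 * m + 1) * h2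

theorem normConst_mul_integral_score_sq {m : ℝ} (hm : 1 / 2 < m) :
    normConst m * ∫ y, score y ^ 2 * (1 + y ^ 2) ^ (-m) = (2 * m - 1) / (4 * m * (m + 1)) := by
  have e : (fun y : ℝ => score y ^ 2 * (1 + y ^ 2) ^ (-m))
      = fun y => (1 + y ^ 2) ^ (-(m + 1)) - (1 + y ^ 2) ^ (-(m + 1 + 1)) := by
    ext y
    rw [rpow_neg_add_one y (m + 1), rpow_neg_add_one y m, score]
    have := (one_add_sq_pos y).ne'
    field_simp
    ring
  rw [e, integral_sub (integrable_one_add_sq_rpow (by linarith))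
    (integrable_one_add_sq_rpow (by linarith)), mul_sub, normConst_mul_integral_add_one hm,
    normConst_mul_integral_add_two hm]
  have h0 : m + 1 ≠ 0 := by linarith
  have : m ≠ 0 := by linarith
  field_simp
  ring

theorem normConst_mul_integral_scoreDeriv {m : ℝ} (hm : 1 / 2 < m) :
    normConst m * ∫ y, scoreDeriv y * (1 + y ^ 2) ^ (-m) = (2 * m - 1) / (2 * (m + 1)) := by
  have e : (fun y : ℝ => scoreDeriv y * (1 + y ^ 2) ^ (-m))
      = fun y => 2 * (1 + y ^ 2) ^ (-(m + 1 + 1)) - (1 + y ^ 2) ^ (-(m + 1)) := by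
    ext y
    rw [rpow_neg_add_one y (m + 1), rpow_neg_add_one y m, scoreDeriv]
    have := (one_add_sq_pos y).ne'
    field_simp
    ring
  rw [e, integral_sub ((integrable_one_add_sq_rpow (by linarith)).const_mul 2)
    (integrable_one_add_sq_rpow (by linarith)), integral_const_mul, mul_sub, mul_left_comm,
    normConst_mul_integral_add_one hm, normConst_mul_integral_add_two hm]
  have h0 : m + 1 ≠ 0 := by linarith
  have : m ≠ 0 := by linarith
  field_simp
  ring

/-- The difference quotient of `score` between `y - d` and `y`. -/
noncomputable def scoreSlope (d y : ℝ) : ℝ :=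
  (1 - y * (y - d)) / ((1 + y ^ 2) * (1 + (y - d) ^ 2))

theorem score_sub_score (d y : ℝ) : score y - score (y - d) = d * scoreSlope d y := by
  have h1 := (one_add_sq_pos y).ne'
  have h2 := (one_add_sq_pos (y - d)).ne'
  rw [score, score, scoreSlope]
  field_simp
  ring

/-- Uniformity in `y` allows the random `δ n` to replace `d` without a uniform strong law. -/
theorem abs_scoreSlope_sub_le (d y : ℝ) : |scoreSlope d y - scoreDeriv y| ≤ 2 * |d| := by
  have h1 := one_add_sq_pos y
  have h2 := one_add_sq_pos (y - d)
  have e : scoreSlope d y - scoreDeriv y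
      = d * ((2 * y + (y - d) - y ^ 2 * (y - d)) / ((1 + y ^ 2) ^ 2 * (1 + (y - d) ^ 2))) := by
    rw [scoreSlope, scoreDeriv]
    field_simp
    ring
  rw [e, abs_mul, mul_comm]
  refine mul_le_mul_of_nonneg_right ?_ (abs_nonneg d)
  generalize y - d = z at h2
  rw [abs_div, abs_of_pos (by positivity : 0 < (1 + y ^ 2) ^ 2 * (1 + z ^ 2)),
    div_le_iff₀ (by positivity)]
  have a1 := abs_le_one_add_sq y
  have a2 := abs_le_one_add_sq z
  have t1 : |2 * y + z - y ^ 2 * z| ≤ 2 * |y| + |z| + y ^ 2 * |z| := by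
    refine (abs_sub _ _).trans ?_
    rw [abs_mul (y ^ 2), abs_of_nonneg (sq_nonneg y)]
    have := abs_add_le (2 * y) z
    rw [abs_mul, abs_two] at this
    linarith
  have t2 : (1 + y ^ 2) * |z| ≤ (1 + y ^ 2) * ((1 + z ^ 2) / 2) :=
    mul_le_mul_of_nonneg_left a2 h1.le
  have t3 : 1 ≤ 1 + y ^ 2 := by linarith [sq_nonneg y]
  have t4 : (1 + y ^ 2) * 1 ≤ (1 + y ^ 2) * (1 + z ^ 2) :=
    mul_le_mul_of_nonneg_left (by linarith [sq_nonneg z]) h1.le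
  have t5 : 1 * ((1 + y ^ 2) * (1 + z ^ 2)) ≤ (1 + y ^ 2) * ((1 + y ^ 2) * (1 + z ^ 2)) :=
    mul_le_mul_of_nonneg_right t3 (by positivity)
  nlinarith

/-- The negative log-likelihood contribution of `y` at location `d`, up to affine maps. -/
noncomputable def logLoss (d y : ℝ) : ℝ := Real.log (1 + (y - d) ^ 2)

/-! ### The loss function and consistency -/

theorem measurable_logLoss (d : ℝ) : Measurable (logLoss d) := by unfold logLoss; fun_prop

theorem continuous_logLoss (d : ℝ) : Continuous (logLoss d) :=
  Continuous.log (by fun_prop) fun y => (one_add_sq_pos (y - d)).ne'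

theorem logLoss_nonneg (d y : ℝ) : 0 ≤ logLoss d y :=
  Real.log_nonneg (by linarith [sq_nonneg (y - d)])

theorem hasDerivAt_logLoss (y d : ℝ) :
    HasDerivAt (fun t => logLoss t y) (-(2 * score (y - d))) d := by
  have h1 : HasDerivAt (fun t => 1 + (y - t) ^ 2) (-(2 * (y - d))) d := by
    simpa using (((hasDerivAt_id d).const_sub y).pow 2).const_add 1
  refine (h1.log (one_add_sq_pos (y - d)).ne').congr_deriv ?_
  rw [score]; ring

theorem abs_logLoss_sub_le (y d e : ℝ) : |logLoss d y - logLoss e y| ≤ |d - e| := by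
  have h := Convex.norm_image_sub_le_of_norm_hasDerivWithin_le (𝕜 := ℝ) (f := fun t => logLoss t y)
    (f' := fun t => -(2 * score (y - t))) (C := 1) (s := Set.univ) (x := e) (y := d)
    (fun t _ => (hasDerivAt_logLoss y t).hasDerivWithinAt) (fun t _ => ?_) convex_univ
    (Set.mem_univ _) (Set.mem_univ _)
  · simpa using h
  · have hp := one_add_sq_pos (y - t)
    rw [norm_neg, norm_mul, Real.norm_eq_abs, Real.norm_eq_abs, abs_two, score, abs_div,
      abs_of_pos hp, ← mul_div_assoc, div_le_one hp]
    linarith [abs_le_one_add_sq (y - t)]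

/-- Coercivity, from `d = y - (y - d)` and hence `d ^ 2 ≤ 2 * y ^ 2 + 2 * (y - d) ^ 2`. -/
theorem log_one_add_sq_le (d y : ℝ) :
    Real.log (1 + d ^ 2) ≤ Real.log 2 + logLoss 0 y + logLoss d y := by
  have h0 := one_add_sq_pos (y - d)
  have h1 := one_add_sq_pos y
  rw [logLoss, logLoss, sub_zero, ← Real.log_mul two_ne_zero h1.ne',
    ← Real.log_mul (by positivity) h0.ne']
  refine Real.log_le_log (one_add_sq_pos d) ?_
  nlinarith [sq_nonneg (y + (y - d)), mul_nonneg (sq_nonneg y) (sq_nonneg (y - d))]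

theorem integrable_logLoss {m : ℝ} (hm : 1 / 2 < m) (d : ℝ) :
    Integrable fun y : ℝ => logLoss d y * (1 + y ^ 2) ^ (-m) := by
  -- The logarithm is absorbed in a power `s` so small that `m - s` still exceeds `1 / 2`.
  set s := (m - 1 / 2) / 2 with hs
  have hspos : 0 < s := by rw [hs]; linarith
  have hi := ((integrable_one_add_sq_rpow (k := m - s) (by rw [hs]; linarith)).const_mul s⁻¹).add
    ((integrable_one_add_sq_rpow hm).const_mul |d|)
  refine hi.mono' ((continuous_logLoss d).mul
    (continuous_one_add_sq_rpow (-m))).aestronglyMeasurable (Eventually.of_forall fun y => ?_)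
  have hp := one_add_sq_pos y
  have hr := Real.rpow_pos_of_pos hp (-m)
  rw [Real.norm_of_nonneg (mul_nonneg (logLoss_nonneg d y) hr.le)]
  have h1 : logLoss 0 y ≤ (1 + y ^ 2) ^ s / s := by
    rw [logLoss, sub_zero]
    exact Real.log_le_rpow_div hp.le hspos
  have h2 := (abs_le.mp (abs_logLoss_sub_le y d 0)).2
  rw [sub_zero] at h2
  have h3 : (1 + y ^ 2) ^ (-(m - s)) = (1 + y ^ 2) ^ s * (1 + y ^ 2) ^ (-m) := by
    rw [← Real.rpow_add hp]; congr 1; ring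
  simp only [Pi.add_apply]
  rw [h3]
  calc logLoss d y * (1 + y ^ 2) ^ (-m) ≤ ((1 + y ^ 2) ^ s / s + |d|) * (1 + y ^ 2) ^ (-m) :=
        mul_le_mul_of_nonneg_right (by linarith) hr.le
    _ = _ := by ring

/-- Gibbs' inequality: with `r` the ratio of the shifted to the unshifted density, the gap is the
integral of `r - 1 - log r ≥ 0`. -/
theorem integral_logLoss_lt {m : ℝ} (hm : 1 / 2 < m) {d : ℝ} (hd : d ≠ 0) :
    ∫ y : ℝ, logLoss 0 y * (1 + y ^ 2) ^ (-m) < ∫ y : ℝ, logLoss d y * (1 + y ^ 2) ^ (-m) := by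
  have i0 := integrable_logLoss hm 0
  have id := integrable_logLoss hm d
  have j0 := integrable_one_add_sq_rpow hm
  have jd : Integrable fun y : ℝ => (1 + (y - d) ^ 2) ^ (-m) := j0.comp_sub_right d
  have ejd : ∫ y : ℝ, (1 + (y - d) ^ 2) ^ (-m) = ∫ y : ℝ, (1 + y ^ 2) ^ (-m) :=
    integral_sub_right_eq_self (fun y : ℝ => (1 + y ^ 2) ^ (-m)) d
  -- The added difference of densities integrates to zero by translation invariance and makes the
  -- integrand pointwise nonnegative.
  set g : ℝ → ℝ := fun y => m * (logLoss d y * (1 + y ^ 2) ^ (-m) - logLoss 0 y * (1 + y ^ 2) ^ (-m))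
    + ((1 + (y - d) ^ 2) ^ (-m) - (1 + y ^ 2) ^ (-m)) with hg
  have hgi : Integrable g := ((id.sub i0).const_mul m).add (jd.sub j0)
  have hgint : ∫ y, g y = m * ((∫ y : ℝ, logLoss d y * (1 + y ^ 2) ^ (-m))
      - ∫ y : ℝ, logLoss 0 y * (1 + y ^ 2) ^ (-m)) := by
    simp only [hg]
    have h1 := integral_add ((id.sub i0).const_mul m) (jd.sub j0)
    simp only [Pi.sub_apply] at h1
    rw [h1, integral_const_mul, integral_sub id i0, integral_sub jd j0, ejd]
    ring
  have hgc : Continuous g := by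
    have c1 := continuous_one_add_sq_rpow (-m)
    have c2 : Continuous fun y : ℝ => (1 + (y - d) ^ 2) ^ (-m) := c1.comp (by fun_prop : Continuous fun y : ℝ => y - d)
    exact ((((continuous_logLoss d).mul c1).sub ((continuous_logLoss 0).mul c1)).const_mul m).add
      (c2.sub c1)
  have hfac : ∀ y, ∃ r, 0 < r ∧ Real.log r = m * (logLoss 0 y - logLoss d y) ∧
      g y = (r - 1 - Real.log r) * (1 + y ^ 2) ^ (-m) := by
    intro y
    have h1 := one_add_sq_pos y
    have h2 := one_add_sq_pos (y - d)
    have p1 := Real.rpow_pos_of_pos h1 (-m)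
    have p2 := Real.rpow_pos_of_pos h2 (-m)
    have hl : Real.log ((1 + (y - d) ^ 2) ^ (-m) / (1 + y ^ 2) ^ (-m))
        = m * (logLoss 0 y - logLoss d y) := by
      rw [Real.log_div p2.ne' p1.ne', Real.log_rpow h2, Real.log_rpow h1, logLoss, logLoss, sub_zero]
      ring
    refine ⟨_, div_pos p2 p1, hl, ?_⟩
    rw [hl, sub_mul, sub_mul, div_mul_cancel₀ _ p1.ne']
    simp only [hg]
    ring
  have hg0 : 0 ≤ g := fun y => by
    obtain ⟨r, hr, -, hgy⟩ := hfac y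
    rw [hgy]
    exact mul_nonneg (by linarith [Real.log_le_sub_one_of_pos hr])
      (Real.rpow_pos_of_pos (one_add_sq_pos y) _).le
  have hne : g 0 ≠ 0 := by
    obtain ⟨r, hr, hlr, hgy⟩ := hfac 0
    rw [hgy]
    have hlr0 : Real.log r ≠ 0 := by
      rw [hlr, logLoss, logLoss]
      have : 0 < Real.log (1 + (0 - d) ^ 2) := Real.log_pos (by
        have : 0 < d ^ 2 := by positivity
        linarith [neg_sq d, zero_sub d, this, sub_sq (0 : ℝ) d])
      simp only [sub_zero, zero_pow two_ne_zero, add_zero, Real.log_one, zero_sub]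
      simp only [zero_sub] at this
      have : 0 < m * Real.log (1 + (-d) ^ 2) := mul_pos (by linarith) this
      linarith
    have hr1 : r ≠ 1 := fun h => hlr0 (by rw [h, Real.log_one])
    have := Real.log_lt_sub_one_of_pos hr hr1
    exact mul_ne_zero (by linarith) (Real.rpow_pos_of_pos (one_add_sq_pos 0) _).ne'
  have hpos : 0 < ∫ y, g y := by
    refine (integral_pos_iff_support_of_nonneg hg0 hgi).mpr ?_
    exact hgc.isOpen_support.measure_pos volume ⟨0, hne⟩
  rw [hgint] at hpos
  have := pos_of_mul_pos_right hpos (by linarith)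
  linarith

/-- Minimizers of averages of `logLoss` converge to `0` once the averages converge at rational
locations to the expected loss. -/
theorem tendsto_zero_of_minimizes {Y : ℕ → ℝ} {δ : ℕ → ℝ} {G : ℝ → ℝ}
    (hmin : ∀ᶠ n in atTop, ∀ t, ∑ i ∈ Finset.range n, logLoss (δ n) (Y i)
      ≤ ∑ i ∈ Finset.range n, logLoss t (Y i))
    (hG : ∀ q : ℚ, Tendsto (fun n : ℕ => (∑ i ∈ Finset.range n, logLoss q (Y i)) / n) atTop
      (𝓝 (G q)))
    (hGlip : ∀ s t, |G s - G t| ≤ |s - t|) (hGmin : ∀ t, t ≠ 0 → G 0 < G t) :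
    Tendsto δ atTop (𝓝 0) := by
  have hG0 : Tendsto (fun n : ℕ => (∑ i ∈ Finset.range n, logLoss 0 (Y i)) / n) atTop
      (𝓝 (G 0)) := by simpa using hG 0
  -- At `d = δ n` both averages in `log_one_add_sq_le` are at most the average loss at `0`,
  -- eventually below `G 0 + 1`.
  set R := Real.exp (Real.log 2 + 2 * (G 0 + 1)) with hR
  have hbdd : ∀ᶠ n in atTop, δ n ∈ Set.Icc (-R) R := by
    filter_upwards [hmin, hG0.eventually (gt_mem_nhds (lt_add_one (G 0))),
      eventually_gt_atTop 0] with n h1 h2 h3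
    have hn : (0 : ℝ) < n := by exact_mod_cast h3
    rw [div_lt_iff₀ hn] at h2
    have h4 : n * Real.log (1 + δ n ^ 2) ≤ n * Real.log 2
        + ∑ i ∈ Finset.range n, logLoss 0 (Y i) + ∑ i ∈ Finset.range n, logLoss (δ n) (Y i) := by
      have := Finset.sum_le_sum fun i (_ : i ∈ Finset.range n) => log_one_add_sq_le (δ n) (Y i)
      simpa [Finset.sum_add_distrib] using this
    have h5 : Real.log (1 + δ n ^ 2) ≤ Real.log 2 + 2 * (G 0 + 1) := by
      refine le_of_mul_le_mul_left ?_ hn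
      linarith [h1 0]
    have h6 : 1 + δ n ^ 2 ≤ R := (Real.log_le_iff_le_exp (one_add_sq_pos _)).mp h5
    refine abs_le.mp ?_
    linarith [abs_le_one_add_sq (δ n), one_add_sq_pos (δ n)]
  refine isCompact_Icc.tendsto_nhds_of_unique_mapClusterPt hbdd fun t _ ht => ?_
  by_contra hne
  -- Five errors of size `e` occur: one from `G t` to `G q`, one from each of the two averages, and
  -- two from moving `q` to `δ n` through `t`.
  set e := (G t - G 0) / 5 with he
  have hepos : 0 < e := div_pos (sub_pos.mpr (hGmin t hne)) (by norm_num)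
  obtain ⟨q, hq1, hq2⟩ := exists_rat_btwn (show t - e < t + e by linarith)
  have hqt : |(q : ℝ) - t| ≤ e := abs_le.mpr ⟨by linarith, by linarith⟩
  have hfreq : ∃ᶠ n in atTop, |δ n - t| < e := by
    have := ht.frequently (Metric.ball_mem_nhds t hepos)
    simpa [Real.dist_eq] using this
  obtain ⟨n, h1, h2, h3, h4, h5⟩ := (hfreq.and_eventually (hmin.and
    (((hG q).eventually (lt_mem_nhds (sub_lt_self (G q) hepos))).and
    ((hG0.eventually (gt_mem_nhds (lt_add_of_pos_right (G 0) hepos))).and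
      (eventually_gt_atTop 0))))).exists
  have hn : (0 : ℝ) < n := by exact_mod_cast h5
  rw [lt_div_iff₀ hn] at h3
  rw [div_lt_iff₀ hn] at h4
  have h6 : ∑ i ∈ Finset.range n, logLoss q (Y i)
      ≤ n * (2 * e) + ∑ i ∈ Finset.range n, logLoss (δ n) (Y i) := by
    have : ∀ i ∈ Finset.range n, logLoss q (Y i) ≤ 2 * e + logLoss (δ n) (Y i) := fun i _ => by
      have a1 := (abs_le.mp (abs_logLoss_sub_le (Y i) q (δ n))).2
      have a2 := abs_sub_le (q : ℝ) t (δ n)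
      rw [abs_sub_comm t] at a2
      linarith
    simpa [Finset.sum_add_distrib] using Finset.sum_le_sum this
  have h7 := h2 0
  have h8 := (abs_le.mp (hGlip t q)).2
  rw [abs_sub_comm] at h8
  have h9 : G q - e < 2 * e + (G 0 + e) := by
    refine lt_of_mul_lt_mul_right ?_ hn.le
    linarith
  linarith

/-! ### Likelihood equation and transfer to the estimator -/

theorem log_likelihood {m : ℝ} (hm : 1 / 2 < m) {n : ℕ} (x : Fin n → ℝ) (t : ℝ) :
    0 < likelihood m x t ∧
      Real.log (likelihood m x t) = n * Real.log (normConst m) - m * ∑ i, logLoss t (x i) := by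
  have hc := normConst_pos hm
  have hp : ∀ i, 0 < density m 0 1 (x i - t) := fun i => by
    have := Real.rpow_pos_of_pos (one_add_sq_pos ((x i - t - 0) / 1)) (-m)
    unfold density; positivity
  refine ⟨Finset.prod_pos fun i _ => hp i, ?_⟩
  rw [likelihood, Real.log_prod fun i _ => (hp i).ne', Finset.mul_sum]
  have : ∀ i, Real.log (density m 0 1 (x i - t)) = Real.log (normConst m) - m * logLoss t (x i) := by
    intro i
    have h := one_add_sq_pos (x i - t)
    simp only [density, sub_zero, div_one, mul_one]
    rw [Real.log_mul hc.ne' (Real.rpow_pos_of_pos h _).ne', Real.log_rpow h, logLoss]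
    ring
  simp [this, Finset.sum_sub_distrib]

theorem IsMLE.sum_logLoss_le {m : ℝ} (hm : 1 / 2 < m) {n : ℕ} {T : (Fin n → ℝ) → ℝ}
    (hT : IsMLE m T) (x : ℕ → ℝ) (θ t : ℝ) :
    ∑ i ∈ Finset.range n, logLoss (T (fun i : Fin n => x i) - θ) (x i - θ)
      ≤ ∑ i ∈ Finset.range n, logLoss t (x i - θ) := by
  set x' : Fin n → ℝ := fun i => x i
  have h1 := hT.isMax x' (t + θ)
  obtain ⟨p1, e1⟩ := log_likelihood hm x' (t + θ)
  obtain ⟨p2, e2⟩ := log_likelihood hm x' (T x')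
  have h2 := Real.log_le_log p1 h1
  rw [e1, e2] at h2
  have h3 : ∑ i, logLoss (T x') (x' i) ≤ ∑ i, logLoss (t + θ) (x' i) := by
    refine le_of_mul_le_mul_left ?_ (show 0 < m by linarith)
    linarith
  rw [← Fin.sum_univ_eq_sum_range (fun i => logLoss (T x' - θ) (x i - θ)),
    ← Fin.sum_univ_eq_sum_range (fun i => logLoss t (x i - θ))]
  refine (le_of_eq ?_).trans (h3.trans (le_of_eq ?_))
  · exact Finset.sum_congr rfl fun i _ => by simp only [logLoss, sub_sub_sub_cancel_right, x']
  · refine Finset.sum_congr rfl fun i _ => ?_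
    simp only [logLoss, x']
    rw [sub_sub, add_comm θ]

theorem sum_score_eq_zero_of_minimizes {n : ℕ} {Y : ℕ → ℝ} {d : ℝ}
    (h : ∀ t, ∑ i ∈ Finset.range n, logLoss d (Y i) ≤ ∑ i ∈ Finset.range n, logLoss t (Y i)) :
    ∑ i ∈ Finset.range n, score (Y i - d) = 0 := by
  have hd : HasDerivAt (fun t => ∑ i ∈ Finset.range n, logLoss t (Y i))
      (∑ i ∈ Finset.range n, -(2 * score (Y i - d))) d :=
    HasDerivAt.fun_sum fun i _ => hasDerivAt_logLoss (Y i) d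
  have := IsLocalMin.hasDerivAt_eq_zero (Eventually.of_forall h) hd
  rw [Finset.sum_neg_distrib, ← Finset.mul_sum] at this
  linarith

theorem limsup_coe_eq {u : ℕ → ℝ} {L : ℝ} (h1 : ∀ e > 0, ∀ᶠ n in atTop, u n ≤ L + e)
    (h2 : ∀ e > 0, ∃ᶠ n in atTop, L - e ≤ u n) :
    limsup (fun n => (u n : EReal)) atTop = (L : EReal) := by
  refine le_antisymm ?_ ?_
  · refine EReal.le_of_forall_lt_iff_le.mp fun z hz => ?_
    have hz' : 0 < z - L := sub_pos.mpr (by exact_mod_cast hz)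
    refine limsup_le_of_le (by isBoundedDefault) ?_
    filter_upwards [h1 _ hz'] with n hn
    exact EReal.coe_le_coe_iff.mpr (by linarith)
  · refine EReal.ge_of_forall_gt_iff_ge.mp fun z hz => ?_
    have hz' : 0 < L - z := sub_pos.mpr (by exact_mod_cast hz)
    refine le_limsup_of_frequently_le ?_ (by isBoundedDefault)
    refine (h2 _ hz').mono fun n hn => ?_
    exact EReal.coe_le_coe_iff.mpr (by linarith)

/-- The law of the iterated logarithm for a sequence `δ` passes from the sums `S n = δ n * (n * R n)`
to `δ` when `R` converges to a positive limit. -/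
theorem limsup_sqrt_mul_eq {S R δ : ℕ → ℝ} {v A : ℝ} (hv : 0 < v) (hA : 0 < A)
    (hS : ∀ n, S n = δ n * (n * R n) ∨ n = 0) (hR : Tendsto R atTop (𝓝 A))
    (hup : ∀ j : ℕ, ∀ᶠ n : ℕ in atTop,
      S n ≤ (1 + 1 / ((j : ℝ) + 1)) * √(2 * v * (n * Real.log (Real.log n))))
    (hlow : ∀ j : ℕ, ∃ᶠ n : ℕ in atTop,
      (1 - 1 / ((j : ℝ) + 2)) * √(2 * v * (n * Real.log (Real.log n))) ≤ S n) :
    limsup (fun n : ℕ => ((√((n : ℝ) / Real.log (Real.log n)) * δ n : ℝ) : EReal)) atTop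
      = ((√(2 * v) / A : ℝ) : EReal) := by
  have hll : ∀ᶠ n : ℕ in atTop, 0 < Real.log (Real.log n) :=
    ((Real.tendsto_log_atTop.comp Real.tendsto_log_atTop).comp
      tendsto_natCast_atTop_atTop).eventually_gt_atTop 0
  have hRpos : ∀ᶠ n in atTop, 0 < R n := hR.eventually (lt_mem_nhds hA)
  have key : ∀ᶠ n : ℕ in atTop, 0 < R n ∧ ∀ c : ℝ,
      (S n ≤ c * √(2 * v * (n * Real.log (Real.log n))) →
        √((n : ℝ) / Real.log (Real.log n)) * δ n ≤ c * √(2 * v) / R n) ∧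
      (c * √(2 * v * (n * Real.log (Real.log n))) ≤ S n →
        c * √(2 * v) / R n ≤ √((n : ℝ) / Real.log (Real.log n)) * δ n) := by
    filter_upwards [hll, hRpos, eventually_gt_atTop 0] with n h1 h2 h3
    have hn : (0 : ℝ) < n := by exact_mod_cast h3
    have hSn := (hS n).resolve_right h3.ne'
    set q := √((n : ℝ) / Real.log (Real.log n)) with hq
    have hq0 : 0 < q := Real.sqrt_pos.mpr (by positivity)
    have e : q * √(2 * v * (n * Real.log (Real.log n))) = √(2 * v) * n := by
      rw [hq, ← Real.sqrt_mul (by positivity),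
        show (n : ℝ) / Real.log (Real.log n) * (2 * v * (n * Real.log (Real.log n)))
          = 2 * v * (n : ℝ) ^ 2 by field_simp,
        Real.sqrt_mul (by positivity), Real.sqrt_sq hn.le]
    refine ⟨h2, fun c => ⟨fun h => ?_, fun h => ?_⟩⟩
    · rw [le_div_iff₀ h2]
      refine le_of_mul_le_mul_right ?_ hn
      have := mul_le_mul_of_nonneg_left h hq0.le
      rw [hSn, mul_left_comm q c, e] at this
      linarith
    · rw [div_le_iff₀ h2]
      refine le_of_mul_le_mul_right ?_ hn
      have := mul_le_mul_of_nonneg_left h hq0.le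
      rw [hSn, mul_left_comm q c, e] at this
      linarith
  have hlim : ∀ c : ℝ, Tendsto (fun n => c * √(2 * v) / R n) atTop (𝓝 (c * √(2 * v) / A)) :=
    fun c => tendsto_const_nhds.div hR hA.ne'
  refine limsup_coe_eq (fun e he => ?_) fun e he => ?_
  · have h1 : Tendsto (fun j : ℕ => (1 + 1 / ((j : ℝ) + 1)) * √(2 * v) / A) atTop
        (𝓝 ((1 + 0) * √(2 * v) / A)) :=
      (((tendsto_one_div_add_atTop_nhds_zero_nat (𝕜 := ℝ)).const_add 1).mul_const _).div_const _
    rw [add_zero, one_mul] at h1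
    obtain ⟨j, hj⟩ := (h1.eventually (gt_mem_nhds (lt_add_of_pos_right _ he))).exists
    filter_upwards [key, hup j, (hlim _).eventually (gt_mem_nhds hj)] with n h2 h3 h4
    exact ((h2.2 _).1 h3).trans h4.le
  · have h0 : Tendsto (fun j : ℕ => 1 / ((j : ℝ) + 2)) atTop (𝓝 0) := by
      have := (tendsto_one_div_add_atTop_nhds_zero_nat (𝕜 := ℝ)).comp (tendsto_add_atTop_nat 1)
      refine this.congr fun j => ?_
      simp only [Function.comp_apply]
      push_cast
      ring
    have h1 : Tendsto (fun j : ℕ => (1 - 1 / ((j : ℝ) + 2)) * √(2 * v) / A) atTop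
        (𝓝 ((1 - 0) * √(2 * v) / A)) :=
      ((h0.const_sub 1).mul_const _).div_const _
    rw [sub_zero, one_mul] at h1
    obtain ⟨j, hj⟩ := (h1.eventually (lt_mem_nhds (sub_lt_self _ he))).exists
    refine ((hlow j).and_eventually (key.and ((hlim _).eventually (lt_mem_nhds hj)))).mono ?_
    rintro n ⟨h2, h3, h4⟩
    exact h4.le.trans ((h3.2 _).2 h2)

/-- Law of the iterated logarithm for maximum likelihood estimators of the location. -/
theorem ae_limsup_mle_eq {Ω : Type*} [MeasurableSpace Ω] (P : Measure Ω) [IsProbabilityMeasure P]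
    (m : ℝ) (hm : 1 / 2 < m) (θ : ℝ)
    (X : ℕ → Ω → ℝ) (hX : ∀ i, Measurable (X i)) (hindep : iIndepFun X P)
    (hlaw : ∀ i, P.map (X i) = dist m θ 1)
    (T : (n : ℕ) → (Fin n → ℝ) → ℝ) (hT : ∀ n, 1 ≤ n → IsMLE m (T n)) :
    ∀ᵐ ω ∂P,
      limsup
        (fun n : ℕ =>
          ((√((n : ℝ) / Real.log (Real.log n)) * (T n (fun i : Fin n => X i ω) - θ) : ℝ) : EReal))
        atTop
      = ((√(2 * (m + 1) / (m * (2 * m - 1))) : ℝ) : EReal) := by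
  have hslln : ∀ g : ℝ → ℝ, Measurable g → Integrable (fun y => g y * (1 + y ^ 2) ^ (-m)) →
      ∀ᵐ ω ∂P, Tendsto (fun n : ℕ => (∑ i ∈ Finset.range n, g (X i ω - θ)) / n) atTop
        (𝓝 (normConst m * ∫ y, g y * (1 + y ^ 2) ^ (-m))) := by
    intro g hgm hgi
    have hgθ : Measurable fun x => g (x - θ) := hgm.comp (measurable_id.sub_const θ)
    have h := strong_law_ae_real (μ := P) (fun i ω => g (X i ω - θ))
      (integrable_comp_sub hm θ (hX 0) (hlaw 0) hgm hgi)
      (fun i j hij => (hindep.indepFun hij).comp hgθ hgθ)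
      (fun i => (IdentDistrib.mk (hX i).aemeasurable (hX 0).aemeasurable
        ((hlaw i).trans (hlaw 0).symm)).comp hgθ)
    rwa [integral_comp_sub hm θ (hX 0) (hlaw 0) hgm] at h
  have hscore : ∀ i, Measurable fun ω => score (X i ω - θ) := fun i =>
    measurable_score.comp ((hX i).sub_const θ)
  have hind' : iIndepFun (fun i ω => score (X i ω - θ)) P :=
    hindep.comp (fun _ x => score (x - θ)) fun _ => measurable_score.comp (measurable_id.sub_const θ)
  have hmean : ∀ i, ∫ ω, score (X i ω - θ) ∂P = 0 := fun i => by
    rw [integral_comp_sub hm θ (hX i) (hlaw i) measurable_score, integral_score, mul_zero]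
  set v := (2 * m - 1) / (4 * m * (m + 1)) with hv
  set A := (2 * m - 1) / (2 * (m + 1)) with hA
  have hm0 : 0 < m := by linarith
  have hm1 : 0 < 2 * m - 1 := by linarith
  have hvpos : 0 < v := by positivity
  have hApos : 0 < A := by positivity
  have hvar : ∀ i, ∫ ω, score (X i ω - θ) ^ 2 ∂P = v := fun i => by
    rw [integral_comp_sub hm θ (hX i) (hlaw i) (g := fun y => score y ^ 2)
      (measurable_score.pow_const 2), normConst_mul_integral_score_sq hm]
  -- Countably many constants tending to `1` suffice, so a single null set serves them all; the
  -- shift `j + 2` below keeps the lower constants positive.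
  have hup := ae_all_iff.mpr fun j : ℕ => BoundedLIL.ae_eventually_sum_le hscore hind'
    (fun i ω => abs_score_le _) hmean hvar hvpos
    (show 1 < 1 + 1 / ((j : ℝ) + 1) by linarith [Nat.one_div_pos_of_nat (α := ℝ) (n := j)])
  have hfrac : ∀ j : ℕ, 0 < 1 / ((j : ℝ) + 2) ∧ 1 / ((j : ℝ) + 2) < 1 := fun j =>
    ⟨by positivity, by rw [div_lt_one (by positivity)]; linarith [Nat.cast_nonneg (α := ℝ) j]⟩
  have hlow := ae_all_iff.mpr fun j : ℕ => BoundedLIL.ae_frequently_le_sum hscore hind'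
    (fun i ω => abs_score_le _) hmean hvar hvpos
    (show 0 < 1 - 1 / ((j : ℝ) + 2) by linarith [(hfrac j).2]) (by linarith [(hfrac j).1])
  have hloss := ae_all_iff.mpr fun q : ℚ =>
    hslln (logLoss q) (measurable_logLoss q) (integrable_logLoss hm q)
  have hderiv := hslln scoreDeriv measurable_scoreDeriv
    ((integrable_one_add_sq_rpow hm).bdd_mul measurable_scoreDeriv.aestronglyMeasurable
      (c := 1) (Eventually.of_forall abs_scoreDeriv_le))
  rw [normConst_mul_integral_scoreDeriv hm] at hderiv
  filter_upwards [hup, hlow, hloss, hderiv] with ω hup hlow hloss hderiv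
  set Y : ℕ → ℝ := fun i => X i ω - θ with hY
  set δ : ℕ → ℝ := fun n => T n (fun i : Fin n => X i ω) - θ with hδ
  have hmin : ∀ n, 1 ≤ n → ∀ t, ∑ i ∈ Finset.range n, logLoss (δ n) (Y i)
      ≤ ∑ i ∈ Finset.range n, logLoss t (Y i) := fun n hn t =>
    (hT n hn).sum_logLoss_le hm (fun i => X i ω) θ t
  have hδ0 : Tendsto δ atTop (𝓝 0) := by
    refine tendsto_zero_of_minimizes
      (G := fun d => normConst m * ∫ y, logLoss d y * (1 + y ^ 2) ^ (-m))
      (eventually_atTop.mpr ⟨1, hmin⟩) hloss (fun s t => ?_) fun t ht => ?_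
    · rw [← mul_sub, ← integral_sub (integrable_logLoss hm s) (integrable_logLoss hm t), abs_mul,
        abs_of_pos (normConst_pos hm)]
      have h1 : |∫ y, (logLoss s y * (1 + y ^ 2) ^ (-m) - logLoss t y * (1 + y ^ 2) ^ (-m))|
          ≤ ∫ y : ℝ, |s - t| * (1 + y ^ 2) ^ (-m) := by
        rw [← Real.norm_eq_abs]
        refine norm_integral_le_of_norm_le ((integrable_one_add_sq_rpow hm).const_mul _)
          (Eventually.of_forall fun y : ℝ => ?_)
        have hr := Real.rpow_pos_of_pos (one_add_sq_pos y) (-m)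
        rw [← sub_mul, norm_mul, Real.norm_of_nonneg hr.le]
        exact mul_le_mul_of_nonneg_right (abs_logLoss_sub_le y s t) hr.le
      rw [integral_const_mul] at h1
      have h2 := mul_le_mul_of_nonneg_left h1 (normConst_pos hm).le
      rwa [mul_left_comm, normConst_mul_integral hm, mul_one] at h2
    · exact mul_lt_mul_of_pos_left (integral_logLoss_lt hm ht) (normConst_pos hm)
  -- The slopes differ from `scoreDeriv` by at most `2 * |δ n|`, so consistency transfers the strong
  -- law to them.
  have hR : Tendsto (fun n : ℕ => (∑ i ∈ Finset.range n, scoreSlope (δ n) (Y i)) / n) atTop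
      (𝓝 A) := by
    refine tendsto_of_tendsto_of_dist hderiv ?_
    refine squeeze_zero' (Eventually.of_forall fun _ => dist_nonneg) ?_
      (show Tendsto (fun n => 2 * |δ n|) atTop (𝓝 0) by simpa using hδ0.abs.const_mul 2)
    filter_upwards [eventually_gt_atTop 0] with n hn
    have hn' : (0 : ℝ) < n := by exact_mod_cast hn
    rw [dist_comm, Real.dist_eq, ← sub_div, abs_div, abs_of_pos hn', div_le_iff₀ hn',
      ← Finset.sum_sub_distrib]
    refine (Finset.abs_sum_le_sum_abs _ _).trans
      ((Finset.sum_le_sum fun i _ => abs_scoreSlope_sub_le (δ n) (Y i)).trans (le_of_eq ?_))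
    simp; ring
  have hS : ∀ n : ℕ, ∑ i ∈ Finset.range n, score (Y i)
      = δ n * (n * ((∑ i ∈ Finset.range n, scoreSlope (δ n) (Y i)) / n)) ∨ n = 0 := by
    intro n
    rcases Nat.eq_zero_or_pos n with h | h
    · exact Or.inr h
    left
    have hn' : (n : ℝ) ≠ 0 := by exact_mod_cast h.ne'
    have h1 := sum_score_eq_zero_of_minimizes (hmin n h)
    rw [mul_div_cancel₀ _ hn', Finset.mul_sum,
      ← Finset.sum_congr rfl fun i _ => score_sub_score (δ n) (Y i), Finset.sum_sub_distrib, h1,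
      sub_zero]
  rw [limsup_sqrt_mul_eq hvpos hApos hS hR hup hlow]
  congr 1
  rw [← Real.sqrt_sq hApos.le, ← Real.sqrt_div (by positivity)]
  congr 1
  rw [hv, hA]
  field_simp
  ring

end PearsonVII

theorem theorem1p3 {Ω : Type*} [MeasurableSpace Ω] (P : Measure Ω) [IsProbabilityMeasure P]
    (m : ℝ) (hm : 1 / 2 < m) (θ : ℝ)
    (X : ℕ → Ω → ℝ) (hX : ∀ i, Measurable (X i)) (hindep : iIndepFun X P)
    (hlaw : ∀ i, P.map (X i) = PearsonVII.dist m θ 1)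
    (T : (n : ℕ) → (Fin n → ℝ) → ℝ) (hT : ∀ n, 1 ≤ n → PearsonVII.IsMLE m (T n)) :
    ∀ᵐ ω ∂P,
      limsup
        (fun n : ℕ =>
          ((√((n : ℝ) / Real.log (Real.log n)) * (T n (fun i : Fin n => X i ω) - θ) : ℝ) : EReal))
        atTop
      = ((√(2 * (m + 1) / (m * (2 * m - 1))) : ℝ) : EReal) :=
  PearsonVII.ae_limsup_mle_eq P m hm θ X hX hindep hlaw T hT
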